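/- Let $p\ge 2$ be even, let $m$ be a positive multiple of $p$ with $m\neq p$, and put $q=m/p$. Let $H=G(m,p,2)\subseteq GL_2(\mathbb C)$ be the group of matrices $PD$ with $P$ a permutation matrix and $D$ a diagonal matrix whose entries are $m$-th roots of unity and $\det(D)^{q}=1$. Let $H$ act on $S=\mathbb C[x,y]$ by linear substitutions, let $R=S^H$, and put $$\sigma_1=(xy)^q,\qquad \sigma_2=x^m+y^m,\qquad z=xy(x^m-y^m),\qquad \Delta=\sigma_1(\sigma_2^2-4\sigma_1^p).$$ Then $\sigma_1,\sigma_2$ are algebraically independent and $R=\mathbb C[\sigma_1,\sigma_2]$; and, for suitable linear forms $\alpha_W$ defining the finitely many reflecting hyperplanes $W$ of $H$, $z=\prod_W\alpha_W$ and $\Delta=\prod_W\alpha_W^{e_W}$, where $e_W$ is the order of the pointwise stabilizer of $W$ in $H$. In particular $z$ divides $\Delta$ in $S$, so $S/(z)$ is a module over $R/(\Delta)$. For a square matrix $\varphi$ of size $n$ over $R$ write $\mathrm{Coker}(\varphi)=R^n/\varphi R^n$, and let $$K_j=\mathrm{Coker}\begin{pmatrix}\sigma_2&2\sigma_1^{j}\\2\sigma_1^{p-j}&\sigma_2\end{pmatrix},\quad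 N_j=\mathrm{Coker}\begin{pmatrix}\sigma_2\sigma_1&-2\sigma_1^{j+1}\\-2\sigma_1^{p+1-j}&\sigma_2\sigma_1\end{pmatrix},\quad X_j=\mathrm{Coker}\begin{pmatrix}\sigma_2&2\sigma_1^{j}\\2\sigma_1^{p+1-j}&\sigma_2\sigma_1\end{pmatrix}\qquad(0\le j\le p),$$ $$C_\pm=\mathrm{Coker}\bigl(\sigma_1(\sigma_2\pm2\sigma_1^{p/2})\bigr),\qquad D_\pm=\mathrm{Coker}\bigl(\sigma_2\mp2\sigma_1^{p/2}\bigr).$$ Each of these matrices is one half of a matrix factorization of $\Delta$, so these cokernels are $R/(\Delta)$-modules. Then, as $R/(\Delta)$-modules, $$\begin{aligned}S/(z)\cong{}&\bigoplus_{j=1}^{p}X_j^{2(q-1)}\oplus\bigoplus_{j=1}^{(p-2)/2}N_j^{2}\oplus\bigoplus_{j=1}^{(p-2)/2}K_j^{2(q-1)^2}\oplus K_{p/2}^{2\binom{q-1}{2}}\oplus K_0^{2\binom{q-1}{2}}\oplus R/(\sigma_1)\oplus\bigl(R/(\sigma_2^2-4\sigma_1^p)\bigr)^{q-1}\\&\oplus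 C_+\oplus D_+^{\,q-1}\oplus C_-\oplus D_-^{\,q-1}\oplus R/(\Delta)\\ \cong{}&\bigoplus_{j=1}^{p}X_j^{2(q-1)}\oplus\bigoplus_{j=1}^{(p-2)/2}N_j^{2}\oplus\bigoplus_{j=1}^{(p-2)/2}K_j^{2(q-1)^2}\oplus R/(\sigma_1)\oplus\bigl(R/(\sigma_2^2-4\sigma_1^p)\bigr)^{q-1+2\binom{q-1}{2}}\\&\oplus C_+\oplus D_+^{\,q-1+2\binom{q-1}{2}}\oplus C_-\oplus D_-^{\,q-1+2\binom{q-1}{2}}\oplus R/(\Delta).\end{aligned}$$ -/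

import Mathlib

open MvPolynomial

noncomputable section

namespace ReflGroup

theorem perm_mul_diagonal_apply {n : ℕ} (w : Equiv.Perm (Fin n)) (d : Fin n → ℂ) (i j : Fin n) :
    (w.permMatrix ℂ * Matrix.diagonal d) i j = if w i = j then d j else 0 := by
  simp [Equiv.Perm.permMatrix, PEquiv.toMatrix_apply, Equiv.toPEquiv_apply, eq_comm]

/-- The complex reflection group `G(m,p,n)`: the matrices `P * D` with `P` a permutation matrix and
`D` a diagonal matrix whose entries are `m`-th roots of unity and which satisfies
`det(D)^(m/p) = 1`. -/
def Gmpn (m p n : ℕ) : Subgroup (Matrix.GeneralLinearGroup (Fin n) ℂ) where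
  carrier := {g | ∃ (w : Equiv.Perm (Fin n)) (d : Fin n → ℂˣ), (∀ i, d i ^ m = 1) ∧
    (∏ i, d i) ^ (m / p) = 1 ∧
    (g : Matrix (Fin n) (Fin n) ℂ) = w.permMatrix ℂ * Matrix.diagonal (fun i => (d i : ℂ))}
  one_mem' := ⟨1, fun _ => 1, by simp, by simp, by simp⟩
  mul_mem' := by
    rintro g h ⟨w, d, hd, hd', hg⟩ ⟨v, e, he, he', hh⟩
    refine ⟨v * w, fun i => d (v.symm i) * e i, fun i => ?_, ?_, ?_⟩
    · rw [mul_pow, hd, he, one_mul]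
    · rw [Finset.prod_mul_distrib, Equiv.prod_comp v.symm d, mul_pow, hd', he', one_mul]
    · rw [Units.val_mul, hg, hh]
      ext i j
      rw [Matrix.mul_apply, perm_mul_diagonal_apply]
      simp only [perm_mul_diagonal_apply, ite_mul, zero_mul, Finset.sum_ite_eq, Finset.mem_univ,
        if_true]
      by_cases hij : v (w i) = j
      · subst hij; simp
      · simp [hij]
  inv_mem' := by
    rintro g ⟨w, d, hd, hd', hg⟩
    refine ⟨w⁻¹, fun i => (d (w i))⁻¹, fun i => ?_, ?_, ?_⟩
    · rw [inv_pow, hd, inv_one]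
    · rw [Finset.prod_inv_distrib, Equiv.prod_comp w d, inv_pow, hd', inv_one]
    · rw [Matrix.coe_units_inv]
      refine Matrix.inv_eq_left_inv ?_
      rw [hg]
      ext i j
      rw [Matrix.mul_apply]
      simp only [perm_mul_diagonal_apply, ite_mul, zero_mul, Finset.sum_ite_eq, Finset.mem_univ,
        if_true]
      by_cases hij : i = j
      · subst hij; simp
      · simp [hij]

/-! ### Invariants and the reflection arrangement of a subgroup of `GL_n(ℂ)` -/

/-- The action of a matrix on polynomial functions on `ℂⁿ` by linear substitution:
`subst g f = f ∘ g`. -/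
def subst {n : ℕ} (g : Matrix.GeneralLinearGroup (Fin n) ℂ) :
    MvPolynomial (Fin n) ℂ →ₐ[ℂ] MvPolynomial (Fin n) ℂ :=
  aeval fun i => ∑ j, C ((g : Matrix (Fin n) (Fin n) ℂ) i j) * X j

/-- The invariant ring `S^G`. -/
def invariants {n : ℕ} (G : Subgroup (Matrix.GeneralLinearGroup (Fin n) ℂ)) :
    Subalgebra ℂ (MvPolynomial (Fin n) ℂ) where
  carrier := {f | ∀ g ∈ G, subst g f = f}
  mul_mem' := fun ha hb g hg => by rw [map_mul, ha g hg, hb g hg]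
  add_mem' := fun ha hb g hg => by rw [map_add, ha g hg, hb g hg]
  algebraMap_mem' := fun r g _ => (subst g).commutes r

/-- The subspace of `ℂⁿ` fixed by `g`. -/
def fixedSpace {n : ℕ} (g : Matrix.GeneralLinearGroup (Fin n) ℂ) : Submodule ℂ (Fin n → ℂ) :=
  LinearMap.ker ((g : Matrix (Fin n) (Fin n) ℂ).mulVecLin - LinearMap.id)

/-- The set `A(G)` of reflecting hyperplanes: the hyperplanes which are the fixed space of an
element of `G`. -/
def hyperplanes {n : ℕ} (G : Subgroup (Matrix.GeneralLinearGroup (Fin n) ℂ)) :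
    Set (Submodule ℂ (Fin n → ℂ)) :=
  {W | Module.finrank ℂ W + 1 = n ∧ ∃ g ∈ G, fixedSpace g = W}

/-- The order `e_W` of the pointwise stabilizer of `W` in `G`. -/
def fixerOrder {n : ℕ} (G : Subgroup (Matrix.GeneralLinearGroup (Fin n) ℂ))
    (W : Submodule ℂ (Fin n → ℂ)) : ℕ :=
  Nat.card {g : Matrix.GeneralLinearGroup (Fin n) ℂ // g ∈ G ∧ W ≤ fixedSpace g}

/-- `a` is a linear form with zero set `W`. -/
def IsDefiningForm {n : ℕ} (W : Submodule ℂ (Fin n → ℂ)) (a : MvPolynomial (Fin n) ℂ) : Prop :=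
  a.IsHomogeneous 1 ∧ ∀ v, v ∈ W ↔ eval v a = 0

/-! ### Matrix factorizations and their cokernels -/

/-- A matrix factorization of `f`, of size `n`. -/
structure MatFact {B : Type} [CommRing B] (f : B) (n : ℕ) where
  φ : Matrix (Fin n) (Fin n) B
  ψ : Matrix (Fin n) (Fin n) B
  mul_eq : φ * ψ = f • (1 : Matrix (Fin n) (Fin n) B)
  mul_eq' : ψ * φ = f • (1 : Matrix (Fin n) (Fin n) B)

namespace MatFact

variable {B : Type} [CommRing B] {f : B} {n : ℕ}

/-- `Coker(φ,ψ) = Coker(φ) = Bⁿ / φ Bⁿ`. -/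
def Coker (M : MatFact f n) : Type := (Fin n → B) ⧸ LinearMap.range M.φ.mulVecLin

instance (M : MatFact f n) : AddCommGroup M.Coker :=
  inferInstanceAs (AddCommGroup ((Fin n → B) ⧸ LinearMap.range M.φ.mulVecLin))

instance (M : MatFact f n) : Module B M.Coker :=
  inferInstanceAs (Module B ((Fin n → B) ⧸ LinearMap.range M.φ.mulVecLin))

theorem isTorsion (M : MatFact f n) : Module.IsTorsionBySet B M.Coker (Ideal.span {f}) := by
  rw [Module.isTorsionBySet_span_singleton_iff]
  intro x
  obtain ⟨v, rfl⟩ := Submodule.Quotient.mk_surjective _ x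
  change Submodule.Quotient.mk (f • v) = 0
  rw [Submodule.Quotient.mk_eq_zero]
  refine ⟨M.ψ.mulVec v, ?_⟩
  simp [Matrix.mulVec_mulVec, M.mul_eq, Matrix.smul_mulVec]

/-- The cokernel is a module over the hypersurface ring `B/(f)`. -/
instance (M : MatFact f n) : Module (B ⧸ Ideal.span {f}) M.Coker := M.isTorsion.module

theorem mk_smul (M : MatFact f n) (b : B) (x : M.Coker) :
    (Ideal.Quotient.mk (Ideal.span {f}) b) • x = b • x := rfl

/-- The `1 × 1` matrix factorization `(a, b)` of `f = a * b`. Its cokernel is `B/(a)`. -/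
def ofMul (a b : B) (h : a * b = f) : MatFact f 1 where
  φ := !![a]
  ψ := !![b]
  mul_eq := by ext i j; fin_cases i; fin_cases j; simp [Matrix.mul_apply, h]
  mul_eq' := by ext i j; fin_cases i; fin_cases j; simp [Matrix.mul_apply, mul_comm b a, h]

end MatFact

/-! ### The Cohen–Macaulay modules over the `D_{p+2}` curve `s (t² - 4 s^p) = 0` -/

section Modules

variable {B : Type} [CommRing B] (s t : B) {p : ℕ}

/-- The equation of the discriminant in terms of `s = σ₁` and `t = σ₂`. -/
def disc (p : ℕ) : B := s * (t ^ 2 - 4 * s ^ p)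

/-- The matrix factorization `(φ_j, ψ_j)`. -/
def phiPsi (j : ℕ) (hj : j ≤ p) : MatFact (disc s t p) 2 where
  φ := !![t, 2 * s ^ j; 2 * s ^ (p - j), t]
  ψ := !![t * s, -2 * s ^ (j + 1); -2 * s ^ (p + 1 - j), t * s]
  mul_eq := by
    obtain ⟨k, rfl⟩ := Nat.exists_eq_add_of_le hj
    rw [show j + k - j = k by omega, show j + k + 1 - j = k + 1 by omega]
    ext a b; fin_cases a <;> fin_cases b <;> simp [disc] <;> ring
  mul_eq' := by
    obtain ⟨k, rfl⟩ := Nat.exists_eq_add_of_le hj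
    rw [show j + k - j = k by omega, show j + k + 1 - j = k + 1 by omega]
    ext a b; fin_cases a <;> fin_cases b <;> simp [disc] <;> ring

/-- The matrix factorization `(ψ_j, φ_j)`. -/
def psiPhi (j : ℕ) (hj : j ≤ p) : MatFact (disc s t p) 2 where
  φ := (phiPsi s t j hj).ψ
  ψ := (phiPsi s t j hj).φ
  mul_eq := (phiPsi s t j hj).mul_eq'
  mul_eq' := (phiPsi s t j hj).mul_eq

/-- The matrix factorization `(ξ_j, η_j)`. -/
def xiEta (j : ℕ) (hj : j ≤ p) : MatFact (disc s t p) 2 where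
  φ := !![t, 2 * s ^ j; 2 * s ^ (p + 1 - j), t * s]
  ψ := !![t * s, -2 * s ^ j; -2 * s ^ (p + 1 - j), t]
  mul_eq := by
    obtain ⟨k, rfl⟩ := Nat.exists_eq_add_of_le hj
    rw [show j + k + 1 - j = k + 1 by omega]
    ext a b; fin_cases a <;> fin_cases b <;> simp [disc] <;> ring
  mul_eq' := by
    obtain ⟨k, rfl⟩ := Nat.exists_eq_add_of_le hj
    rw [show j + k + 1 - j = k + 1 by omega]
    ext a b; fin_cases a <;> fin_cases b <;> simp [disc] <;> ring

/-- `X_j = Coker(ξ_j, η_j)`. -/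
abbrev XMod (j : ℕ) (hj : j ≤ p) : Type := (xiEta s t j hj).Coker

/-- `K_j = Coker(φ_j, ψ_j)`. -/
abbrev KMod (j : ℕ) (hj : j ≤ p) : Type := (phiPsi s t j hj).Coker

/-- `N_j = Coker(ψ_j, φ_j)`. -/
abbrev NMod (j : ℕ) (hj : j ≤ p) : Type := (psiPhi s t j hj).Coker

/-- `A = Coker(σ₁, σ₂² - 4 σ₁^p) = R/(σ₁)`. -/
abbrev AMod (p : ℕ) : Type :=
  (MatFact.ofMul (f := disc s t p) s (t ^ 2 - 4 * s ^ p) rfl).Coker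

/-- `B = Coker(σ₂² - 4 σ₁^p, σ₁) = R/(σ₂² - 4 σ₁^p)`. -/
abbrev BMod (p : ℕ) : Type :=
  (MatFact.ofMul (f := disc s t p) (t ^ 2 - 4 * s ^ p) s (mul_comm _ _)).Coker

theorem disc_plus (hp : Even p) :
    (s * (t + 2 * s ^ (p / 2))) * (t - 2 * s ^ (p / 2)) = disc s t p := by
  obtain ⟨k, rfl⟩ := hp
  rw [show (k + k) / 2 = k by omega, disc]; ring

theorem disc_minus (hp : Even p) :
    (s * (t - 2 * s ^ (p / 2))) * (t + 2 * s ^ (p / 2)) = disc s t p := by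
  rw [← disc_plus s t hp]; ring

/-- `C₊ = Coker(σ₁ (σ₂ + 2 σ₁^(p/2)), σ₂ - 2 σ₁^(p/2))`. -/
abbrev CPlus (hp : Even p) : Type :=
  (MatFact.ofMul (s * (t + 2 * s ^ (p / 2))) (t - 2 * s ^ (p / 2)) (disc_plus s t hp)).Coker

/-- `D₊ = Coker(σ₂ - 2 σ₁^(p/2), σ₁ (σ₂ + 2 σ₁^(p/2)))`. -/
abbrev DPlus (hp : Even p) : Type :=
  (MatFact.ofMul (t - 2 * s ^ (p / 2)) (s * (t + 2 * s ^ (p / 2)))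
    ((mul_comm _ _).trans (disc_plus s t hp))).Coker

/-- `C₋ = Coker(σ₁ (σ₂ - 2 σ₁^(p/2)), σ₂ + 2 σ₁^(p/2))`. -/
abbrev CMinus (hp : Even p) : Type :=
  (MatFact.ofMul (s * (t - 2 * s ^ (p / 2))) (t + 2 * s ^ (p / 2)) (disc_minus s t hp)).Coker

/-- `D₋ = Coker(σ₂ + 2 σ₁^(p/2), σ₁ (σ₂ - 2 σ₁^(p/2)))`. -/
abbrev DMinus (hp : Even p) : Type :=
  (MatFact.ofMul (t + 2 * s ^ (p / 2)) (s * (t - 2 * s ^ (p / 2)))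
    ((mul_comm _ _).trans (disc_minus s t hp))).Coker

theorem le_of_mem_Icc (j : Finset.Icc 1 p) : (j : ℕ) ≤ p := (Finset.mem_Icc.mp j.2).2

theorem le_of_mem_Icc_half (j : Finset.Icc 1 ((p - 2) / 2)) : (j : ℕ) ≤ p :=
  (Finset.mem_Icc.mp j.2).2.trans ((Nat.div_le_self _ _).trans (Nat.sub_le _ _))

end Modules

/-! ### The group `H = G(m,p,2)` -/

/-- The invariant ring `R = S^H`, where `S = ℂ[x,y]` and `H = G(m,p,2)`. -/
abbrev R (m p : ℕ) : Subalgebra ℂ (MvPolynomial (Fin 2) ℂ) := invariants (Gmpn m p 2)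

/-- An element of `G(m,p,2)` is diagonal or antidiagonal. -/
theorem subst_cases {m p : ℕ} {g : Matrix.GeneralLinearGroup (Fin 2) ℂ} (hg : g ∈ Gmpn m p 2) :
    ∃ a b : ℂ, a ^ m = 1 ∧ b ^ m = 1 ∧ (a * b) ^ (m / p) = 1 ∧
      ((subst g (X 0) = C a * X 0 ∧ subst g (X 1) = C b * X 1) ∨
        (subst g (X 0) = C a * X 1 ∧ subst g (X 1) = C b * X 0)) := by
  obtain ⟨w, d, hd, hd', hg⟩ := hg
  have hu : ∀ i, (d i : ℂ) ^ m = 1 := fun i => by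
    rw [← Units.val_pow_eq_pow_val, hd i, Units.val_one]
  have hu' : ((d 0 : ℂ) * d 1) ^ (m / p) = 1 := by
    rw [Fin.prod_univ_two] at hd'
    rw [← Units.val_mul, ← Units.val_pow_eq_pow_val, hd', Units.val_one]
  have h : ∀ i, subst g (X i) = C (d (w i) : ℂ) * X (w i) := fun i => by
    simp only [subst, aeval_X, hg, perm_mul_diagonal_apply, apply_ite C, C_0, ite_mul, zero_mul,
      Finset.sum_ite_eq, Finset.mem_univ, if_true]
  refine ⟨d (w 0), d (w 1), hu _, hu _, ?_, ?_⟩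
  · obtain hw | hw := (by decide : ∀ w : Equiv.Perm (Fin 2),
      (w 0 = 0 ∧ w 1 = 1) ∨ (w 0 = 1 ∧ w 1 = 0)) w
    · rw [hw.1, hw.2, hu']
    · rw [hw.1, hw.2, mul_comm, hu']
  · obtain hw | hw := (by decide : ∀ w : Equiv.Perm (Fin 2),
      (w 0 = 0 ∧ w 1 = 1) ∨ (w 0 = 1 ∧ w 1 = 0)) w
    · left; rw [h, h, hw.1, hw.2]; exact ⟨rfl, rfl⟩
    · right; rw [h, h, hw.1, hw.2]; exact ⟨rfl, rfl⟩

/-- `σ₁ = (xy)^q`, with `q = m/p`. -/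
def sigma1 (m p : ℕ) : R m p :=
  ⟨(X 0 * X 1) ^ (m / p), fun g hg => by
    obtain ⟨a, b, -, -, hab, ⟨h0, h1⟩ | ⟨h0, h1⟩⟩ := subst_cases hg
    · rw [map_pow, map_mul, h0, h1, show (C a * X 0 * (C b * X 1) : MvPolynomial (Fin 2) ℂ)
        = C (a * b) * (X 0 * X 1) by rw [C_mul]; ring, mul_pow, ← C_pow, hab, C_1, one_mul]
    · rw [map_pow, map_mul, h0, h1, show (C a * X 1 * (C b * X 0) : MvPolynomial (Fin 2) ℂ)
        = C (a * b) * (X 0 * X 1) by rw [C_mul]; ring, mul_pow, ← C_pow, hab, C_1, one_mul]⟩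

/-- `σ₂ = x^m + y^m`. -/
def sigma2 (m p : ℕ) : R m p :=
  ⟨X 0 ^ m + X 1 ^ m, fun g hg => by
    obtain ⟨a, b, ha, hb, -, ⟨h0, h1⟩ | ⟨h0, h1⟩⟩ := subst_cases hg
    · rw [map_add, map_pow, map_pow, h0, h1, mul_pow, mul_pow, ← C_pow, ← C_pow, ha, hb, C_1,
        one_mul, one_mul]
    · rw [map_add, map_pow, map_pow, h0, h1, mul_pow, mul_pow, ← C_pow, ← C_pow, ha, hb, C_1,
        one_mul, one_mul, add_comm]⟩

/-- The equation `z = xy(x^m - y^m)` of the reduced hyperplane arrangement of `G(m,p,2)`,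
for `m ≠ p`. -/
def z (m : ℕ) : MvPolynomial (Fin 2) ℂ := X 0 * X 1 * (X 0 ^ m - X 1 ^ m)

/-- The discriminant `Δ = σ₁(σ₂² - 4σ₁^p) ∈ R` of `G(m,p,2)`, for `m ≠ p`. -/
abbrev Delta (m p : ℕ) : R m p := disc (sigma1 m p) (sigma2 m p) p

/-- The coordinate ring `R/(Δ)` of the discriminant. -/
abbrev RDelta (m p : ℕ) : Type := R m p ⧸ Ideal.span {Delta m p}

theorem z_dvd_Delta {m p : ℕ} (hm : 0 < m) (hpm : p ∣ m) :
    z m ∣ (Delta m p : MvPolynomial (Fin 2) ℂ) := by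
  obtain ⟨q, rfl⟩ := hpm
  have hp : 0 < p := Nat.pos_of_mul_pos_right hm
  obtain ⟨k, rfl⟩ : ∃ k, q = k + 1 := Nat.exists_eq_succ_of_ne_zero (by rintro rfl; simp at hm)
  have h4 : ((4 : R (p * (k + 1)) p) : MvPolynomial (Fin 2) ℂ) = 4 := rfl
  refine ⟨(X 0 * X 1) ^ k * (X 0 ^ (p * (k + 1)) - X 1 ^ (p * (k + 1))), ?_⟩
  simp only [Delta, disc, sigma1, sigma2, z, Nat.mul_div_cancel_left _ hp, MulMemClass.coe_mul,
    AddSubgroupClass.coe_sub, SubmonoidClass.coe_pow, h4]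
  rw [← pow_mul, mul_comm (k + 1) p, mul_pow _ _ (p * (k + 1))]
  ring

/-- The coordinate ring `S/(z)` of the reduced hyperplane arrangement. -/
def SModZ {m p : ℕ} (_ : 0 < m) (_ : p ∣ m) : Type :=
  MvPolynomial (Fin 2) ℂ ⧸ Ideal.span {z m}

section

variable {m p : ℕ} (hm : 0 < m) (hpm : p ∣ m)

instance : CommRing (SModZ hm hpm) :=
  inferInstanceAs (CommRing (MvPolynomial (Fin 2) ℂ ⧸ Ideal.span {z m}))

instance : Module (R m p) (SModZ hm hpm) :=
  inferInstanceAs (Module (R m p) (MvPolynomial (Fin 2) ℂ ⧸ Ideal.span {z m}))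

theorem SModZ.isTorsion :
    Module.IsTorsionBySet (R m p) (SModZ hm hpm) (Ideal.span {Delta m p}) := by
  rw [Module.isTorsionBySet_span_singleton_iff]
  intro x
  obtain ⟨f, rfl⟩ := Ideal.Quotient.mk_surjective x
  change Ideal.Quotient.mk (Ideal.span {z m}) ((Delta m p : MvPolynomial (Fin 2) ℂ) * f) = 0
  rw [Ideal.Quotient.eq_zero_iff_mem, Ideal.mem_span_singleton]
  exact (z_dvd_Delta hm hpm).mul_right f

/-- `S/(z)` is a module over `R/(Δ)`, because `z` divides `Δ` in `S`. -/
instance : Module (RDelta m p) (SModZ hm hpm) := (SModZ.isTorsion hm hpm).module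

theorem SModZ.mk_smul_mk (r : R m p) (f : MvPolynomial (Fin 2) ℂ) :
    (Ideal.Quotient.mk (Ideal.span {Delta m p}) r) •
        (show SModZ hm hpm from Ideal.Quotient.mk (Ideal.span {z m}) f) =
      (show SModZ hm hpm from Ideal.Quotient.mk (Ideal.span {z m}) ((r : MvPolynomial (Fin 2) ℂ) * f)) :=
  rfl

end

end ReflGroup

end

/-!
The diagonal subgroup of `H` grades `S = ℂ[x, y]` by its characters. Each isotypic component is
free of rank 2 over `R` on two monomials `x^(a+qk) y^b` and `x^a y^(b+q(p-k))`, where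
`0 ≤ a, b < q`: they span because `σ₁ = (xy)^q` and `σ₂ = x^m + y^m` reduce all exponents, and
they are independent because a relation with coefficients in `R` may be conjugated by the exchange
of `x` and `y`. As the same monomials span `S` over `ℂ[σ₁, σ₂]`, comparing coefficients gives
`R = ℂ[σ₁, σ₂]`.

Multiplication by `xy` raises `a` and `b` by one, so multiplication by `z = xy (x^m - y^m)`
permutes the components. Hence `S/(z)` is the direct sum of the cokernels of `2 × 2` blocks,
which are equivalent to the matrices of `K_k`, `X_{k+1}`, `X_{p+1-k}` or `N_k` according to
which of `a` and `b` wraps around modulo `q`. The four modules `K_0`, `K_{p/2}`, `N_0`,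
`N_{p/2}` decompose further because `2` is invertible.
-/

noncomputable section

namespace ReflGroup

/-! ### Cokernels of matrices -/

section Cokernel

variable {B m n : Type*} [CommRing B] [Fintype n]

/-- The cokernel of a matrix acting on column vectors. -/
abbrev Cokernel (M : Matrix m n B) : Type _ := (m → B) ⧸ LinearMap.range M.mulVecLin

/-- Cokernels of equal matrices. -/
def cokernelCongr {M M' : Matrix m n B} (h : M = M') : Cokernel M ≃ₗ[B] Cokernel M' :=
  Submodule.quotEquivOfEq _ _ (by rw [h])

/-- Equivalent matrices have isomorphic cokernels. -/
def cokernelEquiv [Fintype m] [DecidableEq m] [DecidableEq n] {M M' : Matrix m n B}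
    {P : Matrix m m B} {Q : Matrix n n B} (hP : IsUnit P.det) (hQ : IsUnit Q.det)
    (h : P * M = M' * Q) : Cokernel M ≃ₗ[B] Cokernel M' :=
  Submodule.Quotient.equiv _ _ (P.toLinearEquiv' (P.invertibleOfIsUnitDet hP)) (by
    have hQ' : LinearMap.range Q.mulVecLin = ⊤ := LinearMap.range_eq_top.2 <|
      Matrix.mulVec_surjective_iff_isUnit.2 ((Matrix.isUnit_iff_isUnit_det Q).2 hQ)
    calc (LinearMap.range M.mulVecLin).map P.mulVecLin
        = LinearMap.range (P * M).mulVecLin := by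
          rw [Matrix.mulVecLin_mul, LinearMap.range_comp]
      _ = LinearMap.range M'.mulVecLin := by
          rw [h, Matrix.mulVecLin_mul, LinearMap.range_comp, hQ', Submodule.map_top])

/-- The cokernel of a diagonal matrix is a product of cyclic modules. -/
def cokernelDiagonalEquiv [DecidableEq n] (d : n → B) :
    Cokernel (Matrix.diagonal d) ≃ₗ[B] ((i : n) → B ⧸ Ideal.span {d i}) :=
  (Submodule.quotEquivOfEq _ (Submodule.pi Set.univ fun i => Ideal.span {d i}) (by
    ext v
    simp only [LinearMap.mem_range, Matrix.mulVecLin_apply, Submodule.mem_pi, Set.mem_univ,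
      forall_const, Ideal.mem_span_singleton, dvd_def, funext_iff, Matrix.mulVec_diagonal,
      Classical.skolem, eq_comm])).trans (Submodule.quotientPi _)

/-- The cokernel of a `1 × 1` matrix is cyclic. -/
def cokernelFinOneEquiv (a : B) : Cokernel !![a] ≃ₗ[B] B ⧸ Ideal.span {a} :=
  (cokernelCongr (by ext i j; fin_cases i; fin_cases j; rfl)).trans
    ((cokernelDiagonalEquiv fun _ : Fin 1 => a).trans
      (LinearEquiv.funUnique (Fin 1) B (B ⧸ Ideal.span {a})))

/-- A matrix equivalent to `diag(a, b)` has cokernel `B/(a) × B/(b)`. -/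
def cokernelEquivProd {M P Q : Matrix (Fin 2) (Fin 2) B} {a b : B} (hP : IsUnit P.det)
    (hQ : IsUnit Q.det) (h : P * M = !![a, 0; 0, b] * Q) :
    Cokernel M ≃ₗ[B] (B ⧸ Ideal.span {a}) × (B ⧸ Ideal.span {b}) :=
  (cokernelEquiv hP hQ (M' := Matrix.diagonal ![a, b])
    (by rw [h, Matrix.diagonal_fin_two]; rfl)).trans
    ((cokernelDiagonalEquiv ![a, b]).trans (LinearEquiv.piFinTwo B _))

/-- An endomorphism which maps the components of a free module to each other through the matrices
`M i` has the product of the cokernels of these matrices as its cokernel. -/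
def quotientRangeEquivPiCokernel {ι S : Type*} [Fintype ι] [DecidableEq ι] [AddCommGroup S]
    [Module B S] (Φ : (ι → n → B) ≃ₗ[B] S) (f : S →ₗ[B] S) (σ : Equiv.Perm ι)
    (M : ι → Matrix n n B) (hf : ∀ u, f (Φ u) = Φ fun i => (M i).mulVec (u (σ i))) :
    (S ⧸ LinearMap.range f) ≃ₗ[B] ((i : ι) → Cokernel (M i)) :=
  (Submodule.Quotient.equiv (LinearMap.range f)
    (Submodule.pi Set.univ fun i => LinearMap.range (M i).mulVecLin) Φ.symm (by
      ext v
      constructor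
      · rintro ⟨_, ⟨w, rfl⟩, rfl⟩ i -
        obtain ⟨u, rfl⟩ := Φ.surjective w
        exact ⟨u (σ i), by simp [hf]⟩
      · intro hv
        choose u hu using fun i => hv i trivial
        refine ⟨f (Φ (u ∘ σ.symm)), ⟨_, rfl⟩, ?_⟩
        simpa [hf] using funext hu)).trans (Submodule.quotientPi _)

end Cokernel

section Presentations

variable {B : Type*} [CommRing B] (s t : B) {p : ℕ}

/-- The matrix `φ_j` presenting `K_j`. -/
def matK (p j : ℕ) : Matrix (Fin 2) (Fin 2) B := !![t, 2 * s ^ j; 2 * s ^ (p - j), t]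

/-- The matrix `ψ_j` presenting `N_j`. -/
def matN (p j : ℕ) : Matrix (Fin 2) (Fin 2) B :=
  !![t * s, -2 * s ^ (j + 1); -2 * s ^ (p + 1 - j), t * s]

/-- The matrix `ξ_j` presenting `X_j`. -/
def matX (p j : ℕ) : Matrix (Fin 2) (Fin 2) B :=
  !![t, 2 * s ^ j; 2 * s ^ (p + 1 - j), t * s]

/-- `K_j ≅ K_{p-j}`. -/
def cokernelMatKSymm {j k : ℕ} (h : j + k = p) :
    Cokernel (matK s t p j) ≃ₗ[B] Cokernel (matK s t p k) :=
  cokernelEquiv (P := !![0, 1; 1, 0]) (Q := !![0, 1; 1, 0]) (by simp) (by simp) (by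
    subst h; simp [matK])

/-- `N_j ≅ N_{p-j}`. -/
def cokernelMatNSymm {j k : ℕ} (h : j + k = p) :
    Cokernel (matN s t p j) ≃ₗ[B] Cokernel (matN s t p k) :=
  cokernelEquiv (P := !![0, 1; 1, 0]) (Q := !![0, 1; 1, 0]) (by simp) (by simp) (by
    subst h
    rw [matN, matN, show j + k + 1 - j = k + 1 by omega, show j + k + 1 - k = j + 1 by omega]
    simp)

variable [Invertible (2 : B)]

/-- `K_0 ≅ B/(t² - 4 s^p)`. -/
def cokernelMatKZeroEquiv :
    Cokernel (matK s t p 0) ≃ₗ[B] B ⧸ Ideal.span {t ^ 2 - 4 * s ^ p} :=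
  have : Subsingleton (B ⧸ Ideal.span {(1 : B)}) :=
    Ideal.Quotient.subsingleton_iff.2 Ideal.span_singleton_one
  letI := Unique.mk' (B ⧸ Ideal.span {(1 : B)})
  (cokernelEquivProd (a := 1) (P := !![1, 0; -⅟2 * t, 1]) (Q := !![t, 2; -⅟2, 0])
    (by simp) (by simp) (by
      rw [matK, Matrix.mul_fin_two, Matrix.mul_fin_two]
      congrm !![?_, ?_; ?_, ?_]
      · ring
      · ring
      · rw [Nat.sub_zero]
        linear_combination (-2 * s ^ p) * invOf_mul_self (2 : B)
      · linear_combination (-t) * invOf_mul_self (2 : B))).trans LinearEquiv.uniqueProd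

/-- `N_0 ≅ B/(s) × B/(s (t² - 4 s^p))`. -/
def cokernelMatNZeroEquiv : Cokernel (matN s t p 0) ≃ₗ[B]
    (B ⧸ Ideal.span {s}) × (B ⧸ Ideal.span {s * (t ^ 2 - 4 * s ^ p)}) :=
  cokernelEquivProd (P := !![1, 0; ⅟2 * t, 1]) (Q := !![t, -2; ⅟2, 0]) (by simp) (by simp) (by
    rw [matN, Matrix.mul_fin_two, Matrix.mul_fin_two]
    congrm !![?_, ?_; ?_, ?_]
    · ring
    · ring
    · rw [Nat.sub_zero]
      linear_combination (2 * s ^ p * s) * invOf_mul_self (2 : B)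
    · linear_combination (-t * s) * invOf_mul_self (2 : B))

theorem isUnit_det_rotation : IsUnit (!![1, -1; 1, 1] : Matrix (Fin 2) (Fin 2) B).det := by
  rw [Matrix.det_fin_two_of, show (1 : B) * 1 - -1 * 1 = 2 by ring]
  exact isUnit_of_invertible 2

/-- `K_{p/2} ≅ B/(t - 2 s^(p/2)) × B/(t + 2 s^(p/2))`. -/
def cokernelMatKHalfEquiv {h : ℕ} (hp : p = h + h) : Cokernel (matK s t p h) ≃ₗ[B]
    (B ⧸ Ideal.span {t - 2 * s ^ h}) × (B ⧸ Ideal.span {t + 2 * s ^ h}) :=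
  cokernelEquivProd isUnit_det_rotation isUnit_det_rotation (by
    rw [matK, hp, Nat.add_sub_cancel, Matrix.mul_fin_two, Matrix.mul_fin_two]
    congrm !![?_, ?_; ?_, ?_] <;> ring)

/-- `N_{p/2} ≅ B/(s (t + 2 s^(p/2))) × B/(s (t - 2 s^(p/2)))`. -/
def cokernelMatNHalfEquiv {h : ℕ} (hp : p = h + h) : Cokernel (matN s t p h) ≃ₗ[B]
    (B ⧸ Ideal.span {s * (t + 2 * s ^ h)}) × (B ⧸ Ideal.span {s * (t - 2 * s ^ h)}) :=
  cokernelEquivProd isUnit_det_rotation isUnit_det_rotation (by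
    rw [matN, hp, show h + h + 1 - h = h + 1 by omega, Matrix.mul_fin_two, Matrix.mul_fin_two]
    congrm !![?_, ?_; ?_, ?_] <;> ring)

end Presentations

section Blocks

variable {B : Type*} [CommRing B] (s t : B) {p : ℕ}

/-- The matrix of multiplication by `z` from one isotypic component to the next. The exponents `ea`
and `eb` record whether the exponents of `x` and of `y` wrap around modulo `q`. -/
def mulBlock (p ea eb k : ℕ) : Matrix (Fin 2) (Fin 2) B :=
  !![s ^ eb * t, 2 * s ^ (ea + (p - k)); -2 * s ^ (eb + k), -(s ^ ea * t)]

/-- A block without wrapping presents `K_k`. -/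
def cokernelMulBlockEquivK (k : ℕ) :
    Cokernel (mulBlock s t p 0 0 k) ≃ₗ[B] Cokernel (matK s t p k) :=
  cokernelEquiv (P := !![0, -1; 1, 0]) (Q := !![0, 1; 1, 0]) (by simp) (by simp) (by
    simp [mulBlock, matK])

/-- A block in which both exponents wrap around presents `N_k`. -/
def cokernelMulBlockEquivN {k : ℕ} (hk : k ≤ p) :
    Cokernel (mulBlock s t p 1 1 k) ≃ₗ[B] Cokernel (matN s t p k) :=
  cokernelEquiv (P := !![0, 1; 1, 0]) (Q := !![0, -1; 1, 0]) (by simp) (by simp) (by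
    rw [mulBlock, matN, show p + 1 - k = 1 + (p - k) by omega, Nat.add_comm k]
    simp [mul_comm s])

/-- A block in which the exponent of `y` wraps around presents `X_{k+1}`. -/
def cokernelMulBlockEquivX (k : ℕ) :
    Cokernel (mulBlock s t p 0 1 k) ≃ₗ[B] Cokernel (matX s t p (k + 1)) :=
  cokernelEquiv (P := !![0, -1; 1, 0]) (Q := !![0, 1; 1, 0]) (by simp) (by simp) (by
    simp [mulBlock, matX, mul_comm s, Nat.add_comm])

/-- A block in which the exponent of `x` wraps around presents `X_{p+1-k}`. -/
def cokernelMulBlockEquivX' {j k : ℕ} (h : j + k = p + 1) (hk : k ≤ p) :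
    Cokernel (mulBlock s t p 1 0 k) ≃ₗ[B] Cokernel (matX s t p j) :=
  cokernelEquiv (P := !![1, 0; 0, -1]) (Q := 1) (by simp) (by simp) (by
    rw [mulBlock, matX, show 1 + (p - k) = j by omega, show p + 1 - j = k by omega]
    simp [mul_comm s])

end Blocks

/-! ### Regrouping direct sums -/

/-- The shift `i ↦ i + 1` from `{0, …, p - 1}` to `{1, …, p}`. -/
def finEquivIcc (p : ℕ) : Fin p ≃ Finset.Icc 1 p where
  toFun i := ⟨i + 1, Finset.mem_Icc.2 (by lia)⟩
  invFun j := ⟨j - 1, by have := Finset.mem_Icc.1 j.2; lia⟩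
  left_inv i := by simp
  right_inv := fun ⟨j, hj⟩ => by
    have := Finset.mem_Icc.1 hj
    ext
    simp only
    lia

section Regroup

variable (B : Type*) [CommRing B]

section Pi

variable {ι κ : Type*}

/-- Exchanging the factors of a double product. -/
def piCommEquiv (F : ι → κ → Type*) [∀ i k, AddCommGroup (F i k)] [∀ i k, Module B (F i k)] :
    (∀ i k, F i k) ≃ₗ[B] ∀ k i, F i k where
  __ := Equiv.piComm F
  map_add' _ _ := rfl
  map_smul' _ _ := rfl

/-- A product over pairs as an iterated product. -/
def piPairEquiv (F : ι → κ → Type*) [∀ i k, AddCommGroup (F i k)] [∀ i k, Module B (F i k)] :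
    (∀ x : ι × κ, F x.1 x.2) ≃ₗ[B] ∀ i k, F i k where
  toFun v i k := v (i, k)
  invFun v x := v x.1 x.2
  map_add' _ _ := rfl
  map_smul' _ _ := rfl
  left_inv _ := rfl
  right_inv _ := rfl

/-- A product of binary products as a binary product of products. -/
def piProdEquiv (F G : ι → Type*) [∀ i, AddCommGroup (F i)] [∀ i, AddCommGroup (G i)]
    [∀ i, Module B (F i)] [∀ i, Module B (G i)] :
    (∀ i, F i × G i) ≃ₗ[B] (∀ i, F i) × ∀ i, G i where
  toFun v := (fun i => (v i).1, fun i => (v i).2)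
  invFun v i := (v.1 i, v.2 i)
  map_add' _ _ := rfl
  map_smul' _ _ := rfl
  left_inv _ := rfl
  right_inv _ := rfl

end Pi

section Power

variable {B} {ι κ M : Type*} [Fintype ι] [Fintype κ] [AddCommGroup M] [Module B M] {a : ℕ}

/-- Powers of a module depend only on the number of factors. -/
def powerEquivOfCard (h : Fintype.card ι = a) : (ι → M) ≃ₗ[B] (Fin a → M) :=
  LinearEquiv.funCongrLeft B M (Fintype.equivFinOfCardEq h).symm

/-- `M^ι × M^κ = M^a` for `a = |ι| + |κ|`. -/
def powerProdEquivOfCard (h : Fintype.card ι + Fintype.card κ = a) :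
    ((ι → M) × (κ → M)) ≃ₗ[B] (Fin a → M) :=
  (LinearEquiv.sumArrowLequivProdArrow ι κ B M).symm.trans
    (powerEquivOfCard (by rw [Fintype.card_sum, h]))

end Power

section Interval

variable (F : ℕ → Type*) [∀ i, AddCommGroup (F i)] [∀ i, Module B (F i)] {p : ℕ}

/-- Reversing the order of the factors `F_0, …, F_{p-1}`. -/
def piRevEquiv : ((i : Fin p) → F i.rev) ≃ₗ[B] ((i : Fin p) → F i) :=
  LinearEquiv.piCongrLeft B (fun i : Fin p => F i) Fin.revPerm

/-- Shifting the indices from `0, …, p - 1` to `1, …, p`. -/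
def piIccEquiv : ((i : Fin p) → F (i + 1)) ≃ₗ[B] ((j : Finset.Icc 1 p) → F j) :=
  LinearEquiv.piCongrLeft B (fun j : Finset.Icc 1 p => F j) (finEquivIcc p)

/-- Splitting off the factor `F_0`. -/
def piZeroSuccEquiv {r : ℕ} (h : r + 1 = p) :
    ((i : Fin p) → F i) ≃ₗ[B] F 0 × ((i : Fin r) → F (i + 1)) :=
  (LinearEquiv.piCongrLeft B (fun i : Fin p => F i) (finCongr h)).symm.trans
    (Fin.consLinearEquiv B fun i : Fin (r + 1) => F i).symm

/-- If `F_j ≅ F_{p-j}`, then `F_0 × ⋯ × F_{p-1}` consists of the two fixed terms `F_0`, `F_{p/2}`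
of `j ↦ p - j` and of two copies of each of `F_1, …, F_{p/2-1}`. -/
def piFoldEquiv {r h : ℕ} (hr : r + 1 = h) (hp : h + h = p)
    (e : ∀ j k, j + k = p → (F j ≃ₗ[B] F k)) :
    ((i : Fin p) → F i) ≃ₗ[B] (F 0 × F h) × ((j : Finset.Icc 1 r) → Fin 2 → F j) :=
  let halves : ((i : Fin p) → F i) ≃ₗ[B] ((i : Fin h) → F i) × ((i : Fin h) → F (h + i)) :=
    (LinearEquiv.piCongrLeft B (fun i : Fin p => F i)
      (finSumFinEquiv.trans (finCongr hp))).symm.trans (LinearEquiv.sumPiEquivProdPi B _ _ _)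
  let reflect : ((i : Fin r) → F (h + (i + 1))) ≃ₗ[B] ((i : Fin r) → F (i + 1)) :=
    (LinearEquiv.piCongrRight fun i : Fin r => e (h + (i + 1)) (i.rev + 1) (by
      rw [Fin.val_rev]; lia)).trans (piRevEquiv B fun i => F (i + 1))
  let double : (((i : Fin r) → F (i + 1)) × ((i : Fin r) → F (i + 1))) ≃ₗ[B]
      ((j : Finset.Icc 1 r) → Fin 2 → F j) :=
    (piProdEquiv B _ _).symm.trans ((LinearEquiv.piCongrRight fun i : Fin r =>
      (LinearEquiv.finTwoArrow B (F (i + 1))).symm).trans (piIccEquiv B fun j => Fin 2 → F j))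
  halves.trans <|
    ((piZeroSuccEquiv B F hr).prodCongr ((piZeroSuccEquiv B (fun i => F (h + i)) hr).trans
      ((LinearEquiv.refl B _).prodCongr reflect))).trans <|
    (LinearEquiv.prodProdProdComm B _ _ _ _).trans ((LinearEquiv.refl B _).prodCongr double)

end Interval

variable {B}

/-- Collecting an array of modules with entries `N` in the corner, `X` in the rest of the first row
and column, and `K` elsewhere. -/
def arrayEquiv {n : ℕ} (G : Fin (n + 1) → Fin (n + 1) → Type*) [∀ a b, AddCommGroup (G a b)]
    [∀ a b, Module B (G a b)] {N X K : Type*} [AddCommGroup N] [Module B N] [AddCommGroup X]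
    [Module B X] [AddCommGroup K] [Module B K] (eN : G 0 0 ≃ₗ[B] N)
    (eX : ∀ a : Fin n, G a.succ 0 ≃ₗ[B] X) (eX' : ∀ b : Fin n, G 0 b.succ ≃ₗ[B] X)
    (eK : ∀ a b : Fin n, G a.succ b.succ ≃ₗ[B] K) :
    (∀ a b, G a b) ≃ₗ[B] (N × (Fin n → Fin n → K)) × (Fin (2 * n) → X) :=
  let headRow : (∀ b, G 0 b) ≃ₗ[B] N × (Fin n → X) :=
    (Fin.consLinearEquiv B (G 0)).symm.trans (eN.prodCongr (LinearEquiv.piCongrRight eX'))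
  let tailRow (a : Fin n) : (∀ b, G a.succ b) ≃ₗ[B] (Fin n → K) × X :=
    (Fin.consLinearEquiv B (G a.succ)).symm.trans <|
      ((eX a).prodCongr (LinearEquiv.piCongrRight (eK a))).trans (LinearEquiv.prodComm B _ _)
  (Fin.consLinearEquiv B fun a => ∀ b, G a b).symm.trans <|
    (headRow.prodCongr ((LinearEquiv.piCongrRight tailRow).trans (piProdEquiv B _ _))).trans <|
    (LinearEquiv.prodProdProdComm B _ _ _ _).trans <|
    (LinearEquiv.refl B _).prodCongr (powerProdEquivOfCard (by rw [Fintype.card_fin, two_mul]))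

end Regroup

/-! ### The direct sum of the blocks -/

/-- The number `1` if the residue `a` is reached from `a - 1` by wrapping around modulo `q`, and `0`
otherwise. -/
def wrap (a : ℕ) : ℕ := if a = 0 then 1 else 0

/-- The exponent `k` of the isotypic component with index `(a, b, κ)`, which is spanned by
`x^(a+qk) y^b` and `x^a y^(b+q(p-k))`. The indices `a, b` are residues modulo `q`; making `k` run
through `{1, …, p}` for `a < b` and through `{0, …, p - 1}` for `b ≤ a` keeps `κ` unchanged under
multiplication by `z`. -/
def level (a b κ : ℕ) : ℕ := κ + if a < b then 1 else 0

section Blocks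

variable {B : Type*} [CommRing B] (s t : B) {p n : ℕ}

/-- The matrix of multiplication by `z` into the isotypic component with index `(a, b, κ)`. -/
abbrev zBlock (p a b κ : ℕ) : Matrix (Fin 2) (Fin 2) B :=
  mulBlock s t p (wrap a) (wrap b) (level a b κ)

/-- The direct sum `K_0 ⊕ ⋯ ⊕ K_{p-1}`. -/
abbrev SumK (p : ℕ) : Type _ := (κ : Fin p) → Cokernel (matK s t p κ)

/-- The direct sum `N_0 ⊕ ⋯ ⊕ N_{p-1}`. -/
abbrev SumN (p : ℕ) : Type _ := (κ : Fin p) → Cokernel (matN s t p κ)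

/-- The direct sum `X_1 ⊕ ⋯ ⊕ X_p`. -/
abbrev SumX (p : ℕ) : Type _ := (κ : Fin p) → Cokernel (matX s t p (κ + 1))

/-- The blocks in which both exponents wrap around. -/
def zBlockZeroZeroEquiv : ((κ : Fin p) → Cokernel (zBlock s t p 0 0 κ)) ≃ₗ[B] SumN s t p :=
  LinearEquiv.piCongrRight fun κ => cokernelMulBlockEquivN s t κ.2.le

/-- The blocks in which only the exponent of `y` wraps around. -/
def zBlockSuccZeroEquiv (a : ℕ) :
    ((κ : Fin p) → Cokernel (zBlock s t p (a + 1) 0 κ)) ≃ₗ[B] SumX s t p :=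
  LinearEquiv.piCongrRight fun κ => cokernelMulBlockEquivX s t κ

/-- The blocks in which only the exponent of `x` wraps around. -/
def zBlockZeroSuccEquiv (b : ℕ) :
    ((κ : Fin p) → Cokernel (zBlock s t p 0 (b + 1) κ)) ≃ₗ[B] SumX s t p :=
  (LinearEquiv.piCongrRight fun κ : Fin p =>
    (cokernelCongr (by rw [zBlock, level, if_pos b.succ_pos]; rfl)).trans
      (cokernelMulBlockEquivX' s t (j := κ.rev + 1) (k := κ + 1) (by rw [Fin.val_rev]; lia)
        κ.2)).trans
    (piRevEquiv B fun i => Cokernel (matX s t p (i + 1)))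

/-- The blocks without wrapping. -/
def zBlockSuccSuccEquiv (a b : ℕ) :
    ((κ : Fin p) → Cokernel (zBlock s t p (a + 1) (b + 1) κ)) ≃ₗ[B] SumK s t p :=
  if h : a < b then
    (LinearEquiv.piCongrRight fun κ : Fin p =>
      (cokernelCongr (by rw [zBlock, level, if_pos (Nat.succ_lt_succ h)]; rfl)).trans <|
        (cokernelMulBlockEquivK s t (κ + 1)).trans <|
          cokernelMatKSymm s t (k := κ.rev) (by rw [Fin.val_rev]; lia)).trans
      (piRevEquiv B fun i => Cokernel (matK s t p i))
  else
    LinearEquiv.piCongrRight fun κ : Fin p =>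
      (cokernelCongr (by rw [zBlock, level, if_neg (by lia)]; rfl)).trans
        (cokernelMulBlockEquivK s t κ)

/-- All blocks of multiplication by `z`, for `q = n + 1`. -/
def zBlocksEquiv (p n : ℕ) :
    ((i : Fin (n + 1) × Fin (n + 1) × Fin p) → Cokernel (zBlock s t p i.1 i.2.1 i.2.2)) ≃ₗ[B]
      (SumN s t p × (Fin n → Fin n → SumK s t p)) × (Fin (2 * n) → SumX s t p) :=
  (piPairEquiv B fun (a : Fin (n + 1)) (x : Fin (n + 1) × Fin p) =>
    Cokernel (zBlock s t p a x.1 x.2)).trans <|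
  (LinearEquiv.piCongrRight fun a : Fin (n + 1) =>
    piPairEquiv B fun (b : Fin (n + 1)) (κ : Fin p) => Cokernel (zBlock s t p a b κ)).trans <|
  arrayEquiv (fun a b => (κ : Fin p) → Cokernel (zBlock s t p a b κ)) (zBlockZeroZeroEquiv s t)
    (fun a => zBlockSuccZeroEquiv s t a) (fun b => zBlockZeroSuccEquiv s t b)
    fun a b => zBlockSuccSuccEquiv s t a b

end Blocks

section Modules

variable {B : Type} [CommRing B] (s t : B) {p : ℕ}

instance isScalarTowerCoker {f : B} {k : ℕ} (M : MatFact f k) :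
    IsScalarTower B (B ⧸ Ideal.span {f}) M.Coker :=
  M.isTorsion.isScalarTower

/-- The cokernel of the matrix factorization `(a, b)` is `B/(a)`. -/
def cokerOfMulEquiv {f : B} (a b : B) (h : a * b = f) :
    (MatFact.ofMul a b h).Coker ≃ₗ[B] B ⧸ Ideal.span {a} :=
  cokernelFinOneEquiv a

variable [Invertible (2 : B)]

/-- `K_0 ≅ R/(σ₂² - 4 σ₁^p)`. -/
def kModZeroEquiv : KMod s t 0 p.zero_le ≃ₗ[B] BMod s t p :=
  (cokernelMatKZeroEquiv s t).trans (cokerOfMulEquiv _ _ _).symm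

/-- `K_{p/2} ≅ D₊ ⊕ D₋`. -/
def kModHalfEquiv (hp : Even p) :
    KMod s t (p / 2) (p.div_le_self 2) ≃ₗ[B] DPlus s t hp × DMinus s t hp :=
  (cokernelMatKHalfEquiv s t (by obtain ⟨k, rfl⟩ := hp; lia)).trans
    ((cokerOfMulEquiv _ _ _).symm.prodCongr (cokerOfMulEquiv _ _ _).symm)

/-- `N_0 ≅ A ⊕ B/(Δ)`. -/
def cokernelMatNZeroEquivAMod :
    Cokernel (matN s t p 0) ≃ₗ[B] AMod s t p × (B ⧸ Ideal.span {disc s t p}) :=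
  (cokernelMatNZeroEquiv s t).trans ((cokerOfMulEquiv _ _ _).symm.prodCongr (LinearEquiv.refl B _))

/-- `N_{p/2} ≅ C₊ ⊕ C₋`. -/
def cokernelMatNHalfEquivCMod (hp : Even p) :
    Cokernel (matN s t p (p / 2)) ≃ₗ[B] CPlus s t hp × CMinus s t hp :=
  (cokernelMatNHalfEquiv s t (by obtain ⟨k, rfl⟩ := hp; lia)).trans
    ((cokerOfMulEquiv _ _ _).symm.prodCongr (cokerOfMulEquiv _ _ _).symm)

end Modules

section Decomposition

variable {B : Type} [CommRing B] (s t : B) {p : ℕ}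

/-- The right-hand side of the first decomposition of `S/(z)`, for `q = n + 1`. -/
abbrev FirstDecomposition (hp : Even p) (n : ℕ) : Type :=
  ((j : Finset.Icc 1 p) → Fin (2 * n) → XMod s t (p := p) j (le_of_mem_Icc j)) ×
  ((j : Finset.Icc 1 ((p - 2) / 2)) → Fin 2 → NMod s t (p := p) j (le_of_mem_Icc_half j)) ×
  ((j : Finset.Icc 1 ((p - 2) / 2)) → Fin (2 * n ^ 2) →
    KMod s t (p := p) j (le_of_mem_Icc_half j)) ×
  (Fin (2 * n.choose 2) → KMod s t (p := p) (p / 2) (Nat.div_le_self p 2)) ×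
  (Fin (2 * n.choose 2) → KMod s t (p := p) 0 (Nat.zero_le p)) ×
  AMod s t p × (Fin n → BMod s t p) × CPlus s t hp × (Fin n → DPlus s t hp) ×
  CMinus s t hp × (Fin n → DMinus s t hp) × (B ⧸ Ideal.span {disc s t p})

/-- The right-hand side of the second decomposition of `S/(z)`, for `q = n + 1`. -/
abbrev SecondDecomposition (hp : Even p) (n : ℕ) : Type :=
  ((j : Finset.Icc 1 p) → Fin (2 * n) → XMod s t (p := p) j (le_of_mem_Icc j)) ×
  ((j : Finset.Icc 1 ((p - 2) / 2)) → Fin 2 → NMod s t (p := p) j (le_of_mem_Icc_half j)) ×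
  ((j : Finset.Icc 1 ((p - 2) / 2)) → Fin (2 * n ^ 2) →
    KMod s t (p := p) j (le_of_mem_Icc_half j)) ×
  AMod s t p × (Fin (n + 2 * n.choose 2) → BMod s t p) × CPlus s t hp ×
  (Fin (n + 2 * n.choose 2) → DPlus s t hp) × CMinus s t hp ×
  (Fin (n + 2 * n.choose 2) → DMinus s t hp) × (B ⧸ Ideal.span {disc s t p})

/-- `X_1 ⊕ ⋯ ⊕ X_p` to the power `a`. -/
def powerSumXEquiv (a : ℕ) : (Fin a → SumX s t p) ≃ₗ[B]
    ((j : Finset.Icc 1 p) → Fin a → XMod s t (p := p) j (le_of_mem_Icc j)) :=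
  (piCommEquiv B _).trans (piIccEquiv B fun j => Fin a → Cokernel (matX s t p j))

/-- The `(n × n)`-th power of `K_0 ⊕ ⋯ ⊕ K_{p-1}`, with isomorphic summands collected. -/
def powerSumKEquiv (hp : Even p) (hp0 : 0 < p) (n : ℕ) : (Fin n → Fin n → SumK s t p) ≃ₗ[B]
    ((Fin n × Fin n → KMod s t 0 p.zero_le) ×
      (Fin n × Fin n → KMod s t (p / 2) (p.div_le_self 2))) ×
    ((j : Finset.Icc 1 ((p - 2) / 2)) → Fin (2 * n ^ 2) →
      KMod s t (p := p) j (le_of_mem_Icc_half j)) :=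
  let fold : SumK s t p ≃ₗ[B] _ :=
    piFoldEquiv B (fun j => Cokernel (matK s t p j)) (r := (p - 2) / 2) (h := p / 2)
      (by obtain ⟨k, rfl⟩ := hp; lia) (by obtain ⟨k, rfl⟩ := hp; lia) fun _ _ =>
      cokernelMatKSymm s t
  let collect : (Fin n × Fin n → (j : Finset.Icc 1 ((p - 2) / 2)) → Fin 2 →
      Cokernel (matK s t p j)) ≃ₗ[B] ((j : Finset.Icc 1 ((p - 2) / 2)) → Fin (2 * n ^ 2) →
        KMod s t (p := p) j (le_of_mem_Icc_half j)) :=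
    (piCommEquiv B _).trans <| LinearEquiv.piCongrRight fun j =>
      (piPairEquiv B fun _ _ => Cokernel (matK s t p j)).symm.trans
        (powerEquivOfCard (by simp; ring))
  (piPairEquiv B fun _ _ => SumK s t p).symm.trans <|
    (LinearEquiv.piCongrRight fun _ => fold).trans <|
    (piProdEquiv B _ _).trans ((piProdEquiv B _ _).prodCongr collect)

theorem add_two_mul_choose_two (n : ℕ) : 2 * n.choose 2 + n = n * n := by
  rw [mul_comm 2, Nat.choose_two_right, Nat.div_mul_cancel (Nat.even_mul_pred_self n).two_dvd]
  cases n with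
  | zero => rfl
  | succ k => simp; ring

/-- `M^(n²) ≅ M^(2 (n choose 2)) ⊕ M^n`. -/
def powerSquareEquiv (M : Type*) [AddCommGroup M] [Module B M] (n : ℕ) :
    (Fin n × Fin n → M) ≃ₗ[B] (Fin (2 * n.choose 2) → M) × (Fin n → M) :=
  (powerEquivOfCard (a := n * n) (by simp)).trans
    (powerProdEquivOfCard (by simp [add_two_mul_choose_two])).symm

variable [Invertible (2 : B)]

/-- `N_0 ⊕ ⋯ ⊕ N_{p-1}`, with isomorphic summands collected. -/
def sumNEquiv (hp : Even p) (hp0 : 0 < p) : SumN s t p ≃ₗ[B]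
    ((AMod s t p × (B ⧸ Ideal.span {disc s t p})) × CPlus s t hp × CMinus s t hp) ×
      ((j : Finset.Icc 1 ((p - 2) / 2)) → Fin 2 → NMod s t (p := p) j (le_of_mem_Icc_half j)) :=
  (piFoldEquiv B (fun j => Cokernel (matN s t p j)) (h := p / 2)
    (by obtain ⟨k, rfl⟩ := hp; lia) (by obtain ⟨k, rfl⟩ := hp; lia) fun _ _ =>
      cokernelMatNSymm s t).trans
  (((cokernelMatNZeroEquivAMod s t).prodCongr (cokernelMatNHalfEquivCMod s t hp)).prodCongr
    (LinearEquiv.refl B _))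

/-- The powers of `K_0`, with `n` copies of `K_0` decomposed. -/
def powerKModZeroEquiv (n : ℕ) : (Fin n × Fin n → KMod s t 0 p.zero_le) ≃ₗ[B]
    (Fin (2 * n.choose 2) → KMod s t 0 p.zero_le) × (Fin n → BMod s t p) :=
  (powerSquareEquiv _ n).trans
    ((LinearEquiv.refl B _).prodCongr (LinearEquiv.piCongrRight fun _ => kModZeroEquiv s t))

/-- The powers of `K_{p/2}`, with `n` copies of `K_{p/2}` decomposed. -/
def powerKModHalfEquiv (hp : Even p) (n : ℕ) :
    (Fin n × Fin n → KMod s t (p / 2) (p.div_le_self 2)) ≃ₗ[B]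
    (Fin (2 * n.choose 2) → KMod s t (p / 2) (p.div_le_self 2)) ×
      (Fin n → DPlus s t hp) × (Fin n → DMinus s t hp) :=
  (powerSquareEquiv _ n).trans ((LinearEquiv.refl B _).prodCongr
    ((LinearEquiv.piCongrRight fun _ => kModHalfEquiv s t hp).trans (piProdEquiv B _ _)))

/-- The cokernel of multiplication by `z` is the first direct sum of the theorem. -/
def firstDecompositionEquiv (hp : Even p) (hp0 : 0 < p) (n : ℕ) :
    ((i : Fin (n + 1) × Fin (n + 1) × Fin p) → Cokernel (zBlock s t p i.1 i.2.1 i.2.2)) ≃ₗ[B]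
      FirstDecomposition s t hp n :=
  (zBlocksEquiv s t p n).trans <|
  (((sumNEquiv s t hp hp0).prodCongr ((powerSumKEquiv s t hp hp0 n).trans
    (((powerKModZeroEquiv s t n).prodCongr (powerKModHalfEquiv s t hp n)).prodCongr
      (LinearEquiv.refl B _)))).prodCongr (powerSumXEquiv s t (2 * n))).trans
  { toFun := fun ⟨⟨⟨⟨⟨a, v⟩, c, c'⟩, y⟩, ⟨⟨k₀, b⟩, kh, d, d'⟩, k⟩, x⟩ =>
      ⟨x, y, k, kh, k₀, a, b, c, d, c', d', v⟩
    invFun := fun ⟨x, y, k, kh, k₀, a, b, c, d, c', d', v⟩ =>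
      ⟨⟨⟨⟨⟨a, v⟩, c, c'⟩, y⟩, ⟨⟨k₀, b⟩, kh, d, d'⟩, k⟩, x⟩
    map_add' := fun _ _ => rfl
    map_smul' := fun _ _ => rfl
    left_inv := fun _ => rfl
    right_inv := fun _ => rfl }

/-- The two direct sums of the theorem agree: the remaining copies of `K_0` and `K_{p/2}` are
decomposed. -/
def firstEquivSecond (hp : Even p) (n : ℕ) :
    FirstDecomposition s t hp n ≃ₗ[B] SecondDecomposition s t hp n :=
  let e₀ : (Fin (2 * n.choose 2) → KMod s t 0 p.zero_le) ≃ₗ[B]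
      (Fin (2 * n.choose 2) → BMod s t p) :=
    LinearEquiv.piCongrRight fun _ => kModZeroEquiv s t
  let eh : (Fin (2 * n.choose 2) → KMod s t (p / 2) (p.div_le_self 2)) ≃ₗ[B]
      (Fin (2 * n.choose 2) → DPlus s t hp) × (Fin (2 * n.choose 2) → DMinus s t hp) :=
    (LinearEquiv.piCongrRight fun _ => kModHalfEquiv s t hp).trans (piProdEquiv B _ _)
  let join (M : Type) [AddCommGroup M] [Module B M] :
      ((Fin n → M) × (Fin (2 * n.choose 2) → M)) ≃ₗ[B] (Fin (n + 2 * n.choose 2) → M) :=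
    powerProdEquivOfCard (by simp)
  let id {M : Type} [AddCommGroup M] [Module B M] : M ≃ₗ[B] M := LinearEquiv.refl B M
  (id.prodCongr <| id.prodCongr <| id.prodCongr <| eh.prodCongr <| e₀.prodCongr id).trans <|
  LinearEquiv.trans
  { toFun := fun ⟨x, y, k, ⟨dh, dh'⟩, b₀, a, b, c, d, c', d', v⟩ =>
      ⟨x, y, k, a, ⟨b, b₀⟩, c, ⟨d, dh⟩, c', ⟨d', dh'⟩, v⟩
    invFun := fun ⟨x, y, k, a, ⟨b, b₀⟩, c, ⟨d, dh⟩, c', ⟨d', dh'⟩, v⟩ =>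
      ⟨x, y, k, ⟨dh, dh'⟩, b₀, a, b, c, d, c', d', v⟩
    map_add' := fun _ _ => rfl
    map_smul' := fun _ _ => rfl
    left_inv := fun _ => rfl
    right_inv := fun _ => rfl }
  (id.prodCongr <| id.prodCongr <| id.prodCongr <| id.prodCongr <| (join _).prodCongr <|
    id.prodCongr <| (join _).prodCongr <| id.prodCongr <| (join _).prodCongr id)

section Quotient

variable {Q : Type*} [AddCommGroup Q] [Module B Q] [Module (B ⧸ Ideal.span {disc s t p}) Q]
  [IsScalarTower B (B ⧸ Ideal.span {disc s t p}) Q] {n : ℕ}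
  (e : Q ≃ₗ[B] ((i : Fin (n + 1) × Fin (n + 1) × Fin p) →
    Cokernel (zBlock s t p i.1 i.2.1 i.2.2)))

/-- The first decomposition of a module over `B/(Δ)`, from a decomposition into blocks over `B`. -/
def equivFirstDecomposition (hp : Even p) (hp0 : 0 < p) :
    Q ≃ₗ[B ⧸ Ideal.span {disc s t p}] FirstDecomposition s t hp n :=
  (e.trans (firstDecompositionEquiv s t hp hp0 n)).extendScalarsOfSurjective
    Ideal.Quotient.mk_surjective

/-- The second decomposition of a module over `B/(Δ)`, from a decomposition into blocks over `B`. -/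
def equivSecondDecomposition (hp : Even p) (hp0 : 0 < p) :
    Q ≃ₗ[B ⧸ Ideal.span {disc s t p}] SecondDecomposition s t hp n :=
  (e.trans ((firstDecompositionEquiv s t hp hp0 n).trans
    (firstEquivSecond s t hp n))).extendScalarsOfSurjective Ideal.Quotient.mk_surjective

end Quotient

end Decomposition

/-! ### Pairs of monomials -/

theorem level_le {p κ : ℕ} (a b : ℕ) (hκ : κ < p) : level a b κ ≤ p := by
  unfold level
  split_ifs <;> lia

theorem coe_finRotate_symm_add_one {q : ℕ} (a : Fin q) :
    ((finRotate q).symm a : ℕ) + 1 = a + q * wrap a := by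
  obtain ⟨c, rfl⟩ := (finRotate q).surjective a
  obtain ⟨n, rfl⟩ := Nat.exists_eq_add_one_of_ne_zero (Fin.pos c).ne'
  rw [Equiv.symm_apply_apply, wrap]
  by_cases hc : c = Fin.last n
  · subst hc
    simp
  · rw [coe_finRotate_of_ne_last hc, if_neg (Nat.succ_ne_zero _), mul_zero, add_zero]

theorem level_finRotate_symm_add_wrap {q : ℕ} (a b : Fin q) (κ : ℕ) :
    level ((finRotate q).symm a) ((finRotate q).symm b) κ + wrap a = level a b κ + wrap b := by
  have ha := coe_finRotate_symm_add_one a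
  have hb := coe_finRotate_symm_add_one b
  unfold level wrap at *
  split_ifs at * <;> lia

theorem exists_eq_level_add {p a b A : ℕ} (hp : 0 < p) (h : b ≤ a ∨ A ≠ 0) :
    ∃ κ < p, ∃ n, A = level a b κ + p * n := by
  unfold level
  split_ifs with hab
  · exact ⟨(A - 1) % p, Nat.mod_lt _ hp, (A - 1) / p, by have := Nat.mod_add_div (A - 1) p; lia⟩
  · exact ⟨A % p, Nat.mod_lt _ hp, A / p, by have := Nat.mod_add_div A p; lia⟩

theorem exists_eq_sub_level_add {p a b D : ℕ} (hp : 0 < p) (h : a < b ∨ D ≠ 0) :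
    ∃ κ < p, ∃ n, D = p - level a b κ + p * n := by
  obtain ⟨κ, hκ, n, hn⟩ := exists_eq_level_add (a := b) (b := a + 1) hp h
  refine ⟨p - 1 - κ, by lia, n, ?_⟩
  rw [hn]
  unfold level
  split_ifs <;> lia

/-- The `ℂ[σ₁, σ₂]`-basis `x^(a+qk) y^b`, `x^a y^(b+q(p-k))` of an isotypic component of `ℂ[x, y]`
under the diagonal matrices in `G(pq,p,2)`. -/
def monomialPair {S : Type*} [CommSemiring S] (x y : S) (p q a b k : ℕ) : Fin 2 → S :=
  ![x ^ (a + q * k) * y ^ b, x ^ a * y ^ (b + q * (p - k))]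

section Pairs

variable {B S : Type*} [CommRing B] [CommRing S] [Algebra B S] {x y : S} {s t : B} {p q : ℕ}
  (hs : algebraMap B S s = (x * y) ^ q) (ht : algebraMap B S t = x ^ (p * q) + y ^ (p * q))

section Mul

variable {a b k a' b' k' ea eb : ℕ} (ha : a + 1 = a' + q * ea) (hb : b + 1 = b' + q * eb)
  (hk : k + ea = k' + eb)

include ha hb hk in
theorem mul_monomialPair_zero : x * y * monomialPair x y p q a b k 0 =
    ((x * y) ^ q) ^ eb * monomialPair x y p q a' b' k' 0 := by
  calc x * y * (x ^ (a + q * k) * y ^ b)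
      = x ^ (a + 1 + q * k) * y ^ (b + 1) := by ring
    _ = x ^ (a' + q * (k + ea)) * y ^ (b' + q * eb) := by rw [ha, hb]; ring
    _ = ((x * y) ^ q) ^ eb * (x ^ (a' + q * k') * y ^ b') := by rw [hk]; ring

include ha hb hk in
theorem mul_monomialPair_one (hkp : k ≤ p) (hkp' : k' ≤ p) :
    x * y * monomialPair x y p q a b k 1 =
      ((x * y) ^ q) ^ ea * monomialPair x y p q a' b' k' 1 := by
  have hl : p - k + eb = p - k' + ea := by lia
  calc x * y * (x ^ a * y ^ (b + q * (p - k)))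
      = x ^ (a + 1) * y ^ (b + 1 + q * (p - k)) := by ring
    _ = x ^ (a' + q * ea) * y ^ (b' + q * (p - k + eb)) := by rw [ha, hb]; ring
    _ = ((x * y) ^ q) ^ ea * (x ^ a' * y ^ (b' + q * (p - k'))) := by rw [hl]; ring

theorem pow_mul_monomialPair_zero (hkp : k ≤ p) : y ^ (p * q) * monomialPair x y p q a b k 0 =
    ((x * y) ^ q) ^ k * monomialPair x y p q a b k 1 := by
  obtain ⟨l, rfl⟩ := Nat.exists_eq_add_of_le hkp
  simp only [monomialPair, Nat.add_sub_cancel_left, Matrix.cons_val_zero, Matrix.cons_val_one]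
  ring

theorem pow_mul_monomialPair_one (hkp : k ≤ p) : x ^ (p * q) * monomialPair x y p q a b k 1 =
    ((x * y) ^ q) ^ (p - k) * monomialPair x y p q a b k 0 := by
  obtain ⟨l, rfl⟩ := Nat.exists_eq_add_of_le hkp
  simp only [monomialPair, Nat.add_sub_cancel_left, Matrix.cons_val_zero, Matrix.cons_val_one]
  ring

include hs ht ha hb hk in
theorem mul_linearCombination_monomialPair (hkp : k ≤ p) (hkp' : k' ≤ p) (v : Fin 2 → B) :
    x * y * (x ^ (p * q) - y ^ (p * q)) *
        Fintype.linearCombination B (monomialPair x y p q a b k) v =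
      Fintype.linearCombination B (monomialPair x y p q a' b' k')
        ((mulBlock s t p ea eb k').mulVec v) := by
  have hf := mul_monomialPair_zero (p := p) (x := x) (y := y) ha hb hk
  have hg := mul_monomialPair_one (x := x) (y := y) ha hb hk hkp hkp'
  have hyf := pow_mul_monomialPair_zero (q := q) (a := a') (b := b') (x := x) (y := y) hkp'
  have hxg := pow_mul_monomialPair_one (q := q) (a := a') (b := b') (x := x) (y := y) hkp'
  simp only [Fintype.linearCombination_apply, Fin.sum_univ_two, mulBlock,
    Algebra.smul_def, Matrix.mulVec, dotProduct, Matrix.of_apply, Matrix.cons_val_zero,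
    Matrix.cons_val_one, map_add, map_mul, map_neg, map_pow, map_ofNat, hs, ht, pow_add]
  linear_combination
    (x ^ (p * q) - y ^ (p * q)) * (algebraMap B S (v 0) * hf + algebraMap B S (v 1) * hg) -
      2 * ((x * y) ^ q) ^ eb * algebraMap B S (v 0) * hyf +
      2 * ((x * y) ^ q) ^ ea * algebraMap B S (v 1) * hxg

end Mul

/-- The `B`-linear combinations of the monomials in the pairs with index `(a, b, κ)`. -/
def combination (B : Type*) {S : Type*} [CommRing B] [CommRing S] [Algebra B S] (x y : S)
    (p q : ℕ) : (Fin q × Fin q × Fin p → Fin 2 → B) →ₗ[B] S :=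
  LinearMap.lsum B _ B fun i =>
    Fintype.linearCombination B (monomialPair x y p q i.1 i.2.1 (level i.1 i.2.1 i.2.2))

/-- The component from which multiplication by `z` maps to a given component. -/
def sourceIndex (p q : ℕ) : Equiv.Perm (Fin q × Fin q × Fin p) :=
  (finRotate q).symm.prodCongr ((finRotate q).symm.prodCongr (Equiv.refl _))

include hs ht in
theorem mul_combination (u : Fin q × Fin q × Fin p → Fin 2 → B) :
    x * y * (x ^ (p * q) - y ^ (p * q)) * combination B x y p q u =
      combination B x y p q fun i =>
        (zBlock s t p i.1 i.2.1 i.2.2).mulVec (u (sourceIndex p q i)) := by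
  simp only [combination, LinearMap.lsum_apply, LinearMap.sum_apply, LinearMap.comp_apply,
    LinearMap.proj_apply, Finset.mul_sum]
  rw [← Equiv.sum_comp (sourceIndex p q)]
  refine Finset.sum_congr rfl fun i _ => ?_
  exact mul_linearCombination_monomialPair hs ht (coe_finRotate_symm_add_one i.1)
    (coe_finRotate_symm_add_one i.2.1) (level_finRotate_symm_add_wrap i.1 i.2.1 i.2.2)
    (level_le _ _ i.2.2.2) (level_le _ _ i.2.2.2) _

section Span

variable {T : Submodule B S} {a b k : ℕ}

include hs ht in
theorem pow_mul_pow_mem_of_monomialPair_mem (hkp : k ≤ p)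
    (hT : ∀ e, monomialPair x y p q a b k e ∈ T) (n : ℕ) :
    x ^ (a + q * (k + p * n)) * y ^ b ∈ T := by
  induction n using Nat.twoStepInduction with
  | zero => exact hT 0
  | one =>
    convert T.sub_mem (T.smul_mem t (hT 0)) (T.smul_mem (s ^ k) (hT 1)) using 1
    rw [Algebra.smul_def, Algebra.smul_def, map_pow, hs, ht, ← pow_mul_monomialPair_zero hkp]
    simp only [monomialPair, Matrix.cons_val_zero]
    ring
  | more n h₀ h₁ =>
    convert T.sub_mem (T.smul_mem t h₁) (T.smul_mem (s ^ p) h₀) using 1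
    rw [Algebra.smul_def, Algebra.smul_def, map_pow, hs, ht]
    ring

theorem monomialPair_swap (hkp : k ≤ p) (e : Fin 2) :
    monomialPair y x p q b a (p - k) e = monomialPair x y p q a b k e.rev := by
  obtain ⟨l, rfl⟩ := Nat.exists_eq_add_of_le hkp
  fin_cases e <;> simp [monomialPair, mul_comm]

include hs ht in
theorem pow_mul_pow_mem (hp : 0 < p) (hq : 0 < q)
    (hT : ∀ a < q, ∀ b < q, ∀ κ < p, ∀ e, monomialPair x y p q a b (level a b κ) e ∈ T)
    (i j : ℕ) : x ^ i * y ^ j ∈ T := by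
  have reduced (a b A D : ℕ) (ha : a < q) (hb : b < q) (h : A = 0 ∨ D = 0) :
      x ^ (a + q * A) * y ^ (b + q * D) ∈ T := by
    by_cases hD : D = 0 ∧ (b ≤ a ∨ A ≠ 0)
    · obtain ⟨κ, hκ, n, rfl⟩ := exists_eq_level_add hp hD.2
      rw [hD.1, mul_zero, add_zero]
      exact pow_mul_pow_mem_of_monomialPair_mem hs ht (level_le a b hκ) (hT a ha b hb κ hκ) n
    · obtain ⟨hA, hD'⟩ : A = 0 ∧ (a < b ∨ D ≠ 0) := by lia
      obtain ⟨κ, hκ, n, rfl⟩ := exists_eq_sub_level_add hp hD'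
      rw [hA, mul_zero, add_zero, mul_comm]
      refine pow_mul_pow_mem_of_monomialPair_mem (hs.trans (by rw [mul_comm]))
        (ht.trans (add_comm _ _))
        (Nat.sub_le _ _) (fun e => ?_) n
      rw [monomialPair_swap (level_le a b hκ)]
      exact hT a ha b hb κ hκ _
  obtain ⟨c, A, D, hA, hD, h⟩ : ∃ c A D, i / q = c + A ∧ j / q = c + D ∧ (A = 0 ∨ D = 0) :=
    ⟨min (i / q) (j / q), i / q - j / q, j / q - i / q, by lia, by lia, by lia⟩
  convert T.smul_mem (s ^ c)
    (reduced (i % q) (j % q) A D (Nat.mod_lt _ hq) (Nat.mod_lt _ hq) h) using 1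
  rw [← Nat.mod_add_div i q, ← Nat.mod_add_div j q, hA, hD, Algebra.smul_def, map_pow, hs]
  simp only [Nat.add_mul_mod_self_left, Nat.mod_mod]
  ring

end Span

theorem combination_single (i : Fin q × Fin q × Fin p) (v : Fin 2 → B) :
    combination B x y p q (Pi.single i v) = Fintype.linearCombination B
      (monomialPair x y p q i.1 i.2.1 (level i.1 i.2.1 i.2.2)) v :=
  LinearMap.lsum_piSingle B _ _ _ _ _

include hs ht in
theorem pow_mul_pow_mem_range_combination (hp : 0 < p) (hq : 0 < q) (i j : ℕ) :
    x ^ i * y ^ j ∈ LinearMap.range (combination B x y p q) :=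
  pow_mul_pow_mem (T := LinearMap.range (combination B x y p q)) hs ht hp hq
    (fun a ha b hb κ hκ e =>
    ⟨Pi.single (⟨a, ha⟩, ⟨b, hb⟩, ⟨κ, hκ⟩) (Pi.single e 1), by
      rw [combination_single, Fintype.linearCombination_apply_single, one_smul]⟩) i j

end Pairs

/-! ### The diagonal and antidiagonal elements of the group -/

/-- The diagonal matrix with entries `a` and `b`. -/
def diagGL (a b : ℂˣ) : Matrix.GeneralLinearGroup (Fin 2) ℂ :=
  Matrix.GeneralLinearGroup.mkOfDetNeZero !![(a : ℂ), 0; 0, (b : ℂ)] (by simp)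

/-- The antidiagonal matrix with first row `(0, a)` and second row `(b, 0)`. -/
def antidiagGL (a b : ℂˣ) : Matrix.GeneralLinearGroup (Fin 2) ℂ :=
  Matrix.GeneralLinearGroup.mkOfDetNeZero !![0, (a : ℂ); (b : ℂ), 0] (by simp)

theorem permMatrix_one_mul_diagonal (d : Fin 2 → ℂ) :
    (1 : Equiv.Perm (Fin 2)).permMatrix ℂ * Matrix.diagonal d = !![d 0, 0; 0, d 1] := by
  ext i j
  fin_cases i <;> fin_cases j <;> simp

theorem permMatrix_swap_mul_diagonal (d : Fin 2 → ℂ) :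
    (Equiv.swap (0 : Fin 2) 1).permMatrix ℂ * Matrix.diagonal d = !![0, d 1; d 0, 0] := by
  ext i j
  fin_cases i <;> fin_cases j <;> simp

theorem mem_Gmpn_two_iff {m p : ℕ} {g : Matrix.GeneralLinearGroup (Fin 2) ℂ} :
    g ∈ Gmpn m p 2 ↔ ∃ a b : ℂˣ, a ^ m = 1 ∧ b ^ m = 1 ∧ (a * b) ^ (m / p) = 1 ∧
      (g = diagGL a b ∨ g = antidiagGL a b) := by
  constructor
  · rintro ⟨w, d, hd, hdet, hg⟩
    rw [Fin.prod_univ_two] at hdet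
    obtain rfl | rfl : w = 1 ∨ w = Equiv.swap 0 1 := by
      clear hg
      decide +revert
    · exact ⟨d 0, d 1, hd 0, hd 1, hdet, Or.inl <| Units.ext <|
        hg.trans (permMatrix_one_mul_diagonal _)⟩
    · exact ⟨d 1, d 0, hd 1, hd 0, by rwa [mul_comm], Or.inr <| Units.ext <|
        hg.trans (permMatrix_swap_mul_diagonal _)⟩
  · rintro ⟨a, b, ha, hb, hab, rfl | rfl⟩
    · exact ⟨1, ![a, b], by simp [Fin.forall_fin_two, ha, hb], by simpa [Fin.prod_univ_two],
        (permMatrix_one_mul_diagonal fun i => (![a, b] i : ℂ)).symm⟩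
    · exact ⟨Equiv.swap 0 1, ![b, a], by simp [Fin.forall_fin_two, ha, hb],
        by simpa [Fin.prod_univ_two, mul_comm b],
        (permMatrix_swap_mul_diagonal fun i => (![b, a] i : ℂ)).symm⟩

/-! ### Invariant polynomials -/

theorem monomial_fin_two {A : Type*} [CommSemiring A] (u : Fin 2 →₀ ℕ) (a : A) :
    monomial u a = C a * (X 0 ^ u 0 * X 1 ^ u 1) := by
  rw [monomial_eq, Finsupp.prod_fintype _ _ (by simp), Fin.prod_univ_two]

theorem subst_diagGL_monomial (a b : ℂˣ) (u : Fin 2 →₀ ℕ) (c : ℂ) :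
    subst (diagGL a b) (monomial u c) = monomial u ((a : ℂ) ^ u 0 * (b : ℂ) ^ u 1 * c) := by
  have h0 : subst (diagGL a b) (X 0) = C (a : ℂ) * X 0 := by
    simp [subst, diagGL, Fin.sum_univ_two]
  have h1 : subst (diagGL a b) (X 1) = C (b : ℂ) * X 1 := by
    simp [subst, diagGL, Fin.sum_univ_two]
  simp only [monomial_fin_two, map_mul, map_pow, algHom_C, h0, h1, algebraMap_eq]
  ring

theorem coeff_subst_diagGL (a b : ℂˣ) (f : MvPolynomial (Fin 2) ℂ) (d : Fin 2 →₀ ℕ) :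
    coeff d (subst (diagGL a b) f) = (a : ℂ) ^ d 0 * (b : ℂ) ^ d 1 * coeff d f := by
  induction f using MvPolynomial.induction_on' with
  | monomial u c =>
    rw [subst_diagGL_monomial, coeff_monomial, coeff_monomial]
    split_ifs with h
    · rw [h]
    · rw [mul_zero]
  | add f g hf hg => rw [map_add, coeff_add, coeff_add, hf, hg, mul_add]

theorem subst_antidiagGL_one_one : subst (antidiagGL 1 1) = rename (Equiv.swap 0 1) := by
  refine MvPolynomial.algHom_ext fun i => ?_
  fin_cases i <;> simp [subst, antidiagGL, Fin.sum_univ_two]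

/-- Weights of `x` and `y` in the group of characters of the diagonal matrices in `G(pq,p,2)`: the
weight of a monomial records its values at `diag(1, η)`, `η ^ q = 1`, and `diag(ζ, ζ⁻¹)`,
`ζ ^ (pq) = 1`. -/
def diagWeight (p q : ℕ) : Fin 2 → ZMod q × ZMod (p * q) := ![(0, 1), (1, -1)]

theorem weight_diagWeight (p q : ℕ) (d : Fin 2 →₀ ℕ) :
    Finsupp.weight (diagWeight p q) d = ((d 1 : ZMod q), (d 0 : ZMod (p * q)) - d 1) := by
  rw [Finsupp.weight_apply, Finsupp.sum_fintype _ _ (by simp), Fin.sum_univ_two]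
  ext <;> simp [diagWeight, sub_eq_add_neg]

section Invariant

variable {p q : ℕ} {f : MvPolynomial (Fin 2) ℂ}

theorem pow_mul_pow_eq_one_of_coeff_ne_zero {m : ℕ} (hf : f ∈ R m p) {d : Fin 2 →₀ ℕ}
    (hd : coeff d f ≠ 0) {a b : ℂˣ} (ha : a ^ m = 1) (hb : b ^ m = 1)
    (hab : (a * b) ^ (m / p) = 1) : a ^ d 0 * b ^ d 1 = 1 := by
  have h := coeff_subst_diagGL a b f d
  rw [hf _ (mem_Gmpn_two_iff.mpr ⟨a, b, ha, hb, hab, Or.inl rfl⟩)] at h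
  exact Units.ext (by simpa using (mul_eq_right₀ hd).mp h.symm)

theorem isWeightedHomogeneous_of_mem_R (hp : 0 < p) (hq : 0 < q) (hf : f ∈ R (p * q) p) :
    IsWeightedHomogeneous (diagWeight p q) f 0 := by
  intro d hd
  have hpq : p * q / p = q := Nat.mul_div_cancel_left q hp
  obtain ⟨η, hη⟩ : ∃ η : ℂˣ, IsPrimitiveRoot η q :=
    ⟨_, (Complex.isPrimitiveRoot_exp q hq.ne').isUnit_unit hq.ne'⟩
  have hpq0 : p * q ≠ 0 := (Nat.mul_pos hp hq).ne'
  obtain ⟨ζ, hζ⟩ : ∃ ζ : ℂˣ, IsPrimitiveRoot ζ (p * q) :=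
    ⟨_, (Complex.isPrimitiveRoot_exp (p * q) hpq0).isUnit_unit hpq0⟩
  have h₁ : (d 1 : ZMod q) = 0 := by
    rw [ZMod.natCast_eq_zero_iff, ← hη.pow_eq_one_iff_dvd]
    simpa using pow_mul_pow_eq_one_of_coeff_ne_zero hf hd (one_pow (p * q))
      (by rw [mul_comm, pow_mul, hη.pow_eq_one, one_pow])
      (by rw [hpq, one_mul, hη.pow_eq_one])
  have h₂ : (d 0 : ZMod (p * q)) - d 1 = 0 := by
    have h := pow_mul_pow_eq_one_of_coeff_ne_zero hf hd hζ.pow_eq_one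
      (by rw [inv_pow, hζ.pow_eq_one, inv_one]) (by rw [mul_inv_cancel, one_pow])
    rw [sub_eq_zero, ZMod.natCast_eq_natCast_iff, hζ.eq_orderOf, ← pow_eq_pow_iff_modEq]
    rwa [inv_pow, mul_inv_eq_one] at h
  rw [weight_diagWeight, h₁, h₂, Prod.mk_zero_zero]

theorem rename_swap_of_mem_R {m : ℕ} (hf : f ∈ R m p) : rename (Equiv.swap 0 1) f = f := by
  rw [← subst_antidiagGL_one_one]
  exact hf _ (mem_Gmpn_two_iff.mpr ⟨1, 1, one_pow _, one_pow _, by simp, Or.inr rfl⟩)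

end Invariant

/-! ### Freeness of the polynomial ring over the invariants -/

theorem eq_zero_of_linearCombination_monomialPair {S : Type*} [CommRing S] [IsDomain S]
    {τ : S →+* S} {x y : S} (hx : τ x = y) (hy : τ y = x) (hx0 : x ≠ 0) (hy0 : y ≠ 0)
    {p q a b k : ℕ} (hxy : x ^ (p * q) ≠ y ^ (p * q)) (hk : k ≤ p) {u : Fin 2 → S}
    (hu : ∀ e, τ (u e) = u e)
    (h : Fintype.linearCombination S (monomialPair x y p q a b k) u = 0) : u = 0 := by
  -- The relation `h` and its image under `τ` are a linear system with determinant `M.det`.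
  let M : Matrix (Fin 2) (Fin 2) S :=
    .of ![monomialPair x y p q a b k, τ ∘ monomialPair x y p q a b k]
  have hdet : M.det = (x * y) ^ (a + b) * (x ^ (p * q) - y ^ (p * q)) := by
    obtain ⟨l, rfl⟩ := Nat.exists_eq_add_of_le hk
    simp only [M, Matrix.det_fin_two, Matrix.of_apply, Matrix.cons_val_zero, Matrix.cons_val_one,
      Function.comp_apply, monomialPair, map_mul, map_pow, hx, hy, Nat.add_sub_cancel_left]
    ring
  refine Matrix.eq_zero_of_mulVec_eq_zero (M := M) ?_ ?_
  · rw [hdet]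
    exact mul_ne_zero (pow_ne_zero _ (mul_ne_zero hx0 hy0)) (sub_ne_zero.mpr hxy)
  · rw [Fintype.linearCombination_apply, Fin.sum_univ_two] at h
    have hτ := congrArg τ h
    rw [map_zero, map_add, smul_eq_mul, smul_eq_mul, map_mul, map_mul, hu, hu] at hτ
    funext i
    fin_cases i
    · simpa [M, Matrix.mulVec, dotProduct, Fin.sum_univ_two, mul_comm _ (u _)] using h
    · simpa [M, Matrix.mulVec, dotProduct, Fin.sum_univ_two, mul_comm _ (u _)] using hτ

section Basis

variable {p q : ℕ}

theorem isWeightedHomogeneous_pow_mul_pow (p q i j : ℕ) :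
    IsWeightedHomogeneous (diagWeight p q) (X 0 ^ i * X 1 ^ j : MvPolynomial (Fin 2) ℂ)
      ((j : ZMod q), (i : ZMod (p * q)) - j) := by
  convert ((isWeightedHomogeneous_X ℂ (diagWeight p q) 0).pow i).mul
    ((isWeightedHomogeneous_X ℂ (diagWeight p q) 1).pow j) using 1
  ext <;> simp [diagWeight, sub_eq_add_neg]

theorem isWeightedHomogeneous_monomialPair (a b : ℕ) {k : ℕ} (hk : k ≤ p) (e : Fin 2) :
    IsWeightedHomogeneous (diagWeight p q)
      (monomialPair (X 0 : MvPolynomial (Fin 2) ℂ) (X 1) p q a b k e : MvPolynomial (Fin 2) ℂ)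
      ((b : ZMod q), ((a + q * k : ℕ) : ZMod (p * q)) - b) := by
  fin_cases e
  · exact isWeightedHomogeneous_pow_mul_pow p q _ _
  · obtain ⟨l, rfl⟩ := Nat.exists_eq_add_of_le hk
    have h : ((k + l : ℕ) * q : ZMod ((k + l) * q)) = 0 := by
      exact_mod_cast ZMod.natCast_self ((k + l) * q)
    have hw : ((b : ZMod q), ((a + q * k : ℕ) : ZMod ((k + l) * q)) - b) =
        (((b + q * (k + l - k) : ℕ) : ZMod q),
          (a : ZMod ((k + l) * q)) - (b + q * (k + l - k) : ℕ)) := by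
      rw [Nat.add_sub_cancel_left, Prod.mk.injEq]
      push_cast at h ⊢
      exact ⟨by simp, by linear_combination h⟩
    rw [hw]
    exact isWeightedHomogeneous_pow_mul_pow _ q _ _

/-- The weight of the component of `ℂ[x, y]` with index `(a, b, κ)`. -/
def indexWeight (i : Fin q × Fin q × Fin p) : ZMod q × ZMod (p * q) :=
  ((i.2.1 : ℕ), ((i.1 + q * level i.1 i.2.1 i.2.2 : ℕ) : ZMod (p * q)) - (i.2.1 : ℕ))

theorem le_add_mul_level {a b κ : ℕ} (hb : b < q) : b ≤ a + q * level a b κ := by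
  unfold level
  split_ifs with h
  · nlinarith
  · exact (not_lt.mp h).trans (Nat.le_add_right _ _)

theorem add_mul_level_lt {a b κ : ℕ} (ha : a < q) (hκ : κ < p) :
    a + q * level a b κ < b + p * q := by
  unfold level
  split_ifs with h <;> nlinarith

theorem indexWeight_injective : Function.Injective (indexWeight (p := p) (q := q)) := by
  rintro ⟨a, b, κ⟩ ⟨a', b', κ'⟩ h
  obtain ⟨h₁, h₂⟩ := Prod.mk.inj h
  dsimp only at h₁ h₂
  rw [ZMod.natCast_eq_natCast_iff', Nat.mod_eq_of_lt b.2, Nat.mod_eq_of_lt b'.2] at h₁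
  obtain rfl := Fin.ext h₁
  rw [sub_left_inj, ZMod.natCast_eq_natCast_iff] at h₂
  have window (a : Fin q) (κ : Fin p) :=
    And.intro (le_add_mul_level (a := a) (κ := κ) b.2) (add_mul_level_lt (b := b) a.2 κ.2)
  have h₃ : (a : ℕ) + q * level a b κ = a' + q * level a' b κ' := by
    obtain ⟨i, hi⟩ := Nat.exists_eq_add_of_le (window a κ).1
    obtain ⟨j, hj⟩ := Nat.exists_eq_add_of_le (window a' κ').1
    rw [hi, hj] at h₂ ⊢
    rw [(Nat.ModEq.add_left_cancel' _ h₂).eq_of_lt_of_lt (by have := window a κ; lia)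
      (by have := window a' κ'; lia)]
  have ha : (a : ℕ) = a' := by
    simpa [Nat.mod_eq_of_lt a.2, Nat.mod_eq_of_lt a'.2] using congrArg (· % q) h₃
  obtain rfl := Fin.ext ha
  have hl := Nat.eq_of_mul_eq_mul_left (Fin.pos a) (Nat.add_left_cancel h₃)
  rw [Fin.ext (Nat.add_right_cancel hl : (κ : ℕ) = κ')]

theorem X_zero_pow_ne_X_one_pow {m : ℕ} (hm : 0 < m) :
    (X 0 ^ m : MvPolynomial (Fin 2) ℂ) ≠ X 1 ^ m := fun h => by
  simpa [hm.ne'] using congrArg (eval ![(1 : ℂ), 0]) h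

theorem combination_apply {B S : Type*} [CommRing B] [CommRing S] [Algebra B S] (x y : S)
    (u : Fin q × Fin q × Fin p → Fin 2 → B) :
    combination B x y p q u = ∑ i, Fintype.linearCombination B
      (monomialPair x y p q i.1 i.2.1 (level i.1 i.2.1 i.2.2)) (u i) := by
  simp [combination, LinearMap.lsum_apply]

theorem combination_map {B B' S : Type*} [CommRing B] [CommRing B'] [CommRing S] [Algebra B S]
    [Algebra B' S] {φ : B → B'} (hφ : ∀ b, algebraMap B' S (φ b) = algebraMap B S b) (x y : S)
    (u : Fin q × Fin q × Fin p → Fin 2 → B) :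
    combination B' x y p q (fun i e => φ (u i e)) = combination B x y p q u := by
  simp only [combination_apply, Fintype.linearCombination_apply, Algebra.smul_def, hφ]

variable (hp : 0 < p) (hq : 0 < q)
include hp hq

theorem eq_zero_of_combination_eq_zero
    {u : Fin q × Fin q × Fin p → Fin 2 → MvPolynomial (Fin 2) ℂ}
    (hu : ∀ i e, u i e ∈ R (p * q) p)
    (h : combination _ (X 0 : MvPolynomial (Fin 2) ℂ) (X 1) p q u = 0) : u = 0 := by
  rw [combination_apply] at h
  have hom (i : Fin q × Fin q × Fin p) : IsWeightedHomogeneous (diagWeight p q)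
      (Fintype.linearCombination (MvPolynomial (Fin 2) ℂ)
        (monomialPair (X 0 : MvPolynomial (Fin 2) ℂ) (X 1) p q i.1 i.2.1
          (level i.1 i.2.1 i.2.2)) (u i))
      (indexWeight i) := by
    rw [Fintype.linearCombination_apply]
    refine IsWeightedHomogeneous.sum _ _ _ fun e _ => ?_
    rw [← zero_add (indexWeight i)]
    exact (isWeightedHomogeneous_of_mem_R hp hq (hu i e)).mul
      (isWeightedHomogeneous_monomialPair _ _ (level_le _ _ i.2.2.2) e)
  funext j
  have hj := congrArg (weightedHomogeneousComponent (diagWeight p q) (indexWeight j)) h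
  rw [map_zero, map_sum, Finset.sum_eq_single j
    (fun i _ hij => (hom i).weightedHomogeneousComponent_ne _ fun hw =>
      hij (indexWeight_injective hw.symm)) (by simp),
    (hom j).weightedHomogeneousComponent_same] at hj
  exact eq_zero_of_linearCombination_monomialPair
    (τ := (rename (R := ℂ) (Equiv.swap (0 : Fin 2) 1)).toRingHom) (by simp) (by simp)
    (X_ne_zero 0) (X_ne_zero 1) (X_zero_pow_ne_X_one_pow (Nat.mul_pos hp hq))
    (level_le _ _ j.2.2.2) (fun e => rename_swap_of_mem_R (hu j e)) hj

theorem combination_injective : Function.Injective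
    (combination (R (p * q) p) (X 0 : MvPolynomial (Fin 2) ℂ) (X 1) p q) := by
  rw [injective_iff_map_eq_zero]
  intro u hu
  rw [← combination_map (φ := Subtype.val) fun _ => rfl] at hu
  have h := eq_zero_of_combination_eq_zero hp hq (fun i e => (u i e).2) hu
  ext i e : 2
  exact Subtype.ext (congrFun₂ h i e)

theorem combination_surjective {B : Type*} [CommRing B] [Algebra ℂ B]
    [Algebra B (MvPolynomial (Fin 2) ℂ)] [IsScalarTower ℂ B (MvPolynomial (Fin 2) ℂ)] {s t : B}
    (hs : algebraMap B (MvPolynomial (Fin 2) ℂ) s = (X 0 * X 1) ^ q)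
    (ht : algebraMap B (MvPolynomial (Fin 2) ℂ) t = X 0 ^ (p * q) + X 1 ^ (p * q)) :
    Function.Surjective (combination B (X 0 : MvPolynomial (Fin 2) ℂ) (X 1) p q) := by
  intro f
  rw [← LinearMap.mem_range]
  induction f using MvPolynomial.induction_on' with
  | monomial u c =>
    rw [monomial_fin_two, ← smul_eq_C_mul]
    exact Submodule.smul_of_tower_mem _ c
      (pow_mul_pow_mem_range_combination hs ht hp hq (u 0) (u 1))
  | add f g hf hg => exact add_mem hf hg

end Basis

/-! ### The basic invariants -/

section BasicInvariants

variable {p q : ℕ} (hp : 0 < p)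

include hp in
theorem coe_sigma1 : (sigma1 (p * q) p : MvPolynomial (Fin 2) ℂ) = (X 0 * X 1) ^ q := by
  simp only [sigma1, Nat.mul_div_cancel_left q hp]

theorem coe_sigma2 (m : ℕ) :
    (sigma2 m p : MvPolynomial (Fin 2) ℂ) = X 0 ^ m + X 1 ^ m := rfl

variable (hq : 0 < q)
include hp hq

theorem R_eq_adjoin : R (p * q) p =
    Algebra.adjoin ℂ {(X 0 * X 1) ^ q, X 0 ^ (p * q) + X 1 ^ (p * q)} := by
  set A := Algebra.adjoin ℂ
    {(X 0 * X 1 : MvPolynomial (Fin 2) ℂ) ^ q, X 0 ^ (p * q) + X 1 ^ (p * q)}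
  have hA : A ≤ R (p * q) p := Algebra.adjoin_le <| by
    rintro _ (rfl | rfl)
    · exact coe_sigma1 (q := q) hp ▸ (sigma1 (p * q) p).2
    · exact (sigma2 (p * q) p).2
  refine le_antisymm (fun f hf => ?_) hA
  obtain ⟨u, hu⟩ := combination_surjective (B := A) hp hq
    (s := ⟨_, Algebra.subset_adjoin (Or.inl rfl)⟩) (t := ⟨_, Algebra.subset_adjoin (Or.inr rfl)⟩)
    rfl rfl f
  -- `f = f • 1` over `R`, so by uniqueness the coefficient of `1` over `A` is `f` as well.
  let o : Fin q × Fin q × Fin p := (⟨0, hq⟩, ⟨0, hq⟩, ⟨0, hp⟩)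
  have hf' : combination (R (p * q) p) (X 0) (X 1) p q
      (Pi.single o (Pi.single 0 ⟨f, hf⟩)) = f := by
    rw [combination_single, Fintype.linearCombination_apply_single]
    simp [monomialPair, level, o, Algebra.smul_def]
  rw [← combination_map (φ := Subalgebra.inclusion hA) fun _ => rfl, ← hf'] at hu
  have h := congrFun₂ (combination_injective hp hq hu) o 0
  rw [Pi.single_eq_same, Pi.single_eq_same] at h
  have hfu : (u o 0 : MvPolynomial (Fin 2) ℂ) = f := congrArg Subtype.val h
  exact hfu ▸ (u o 0).2

theorem adjoin_sigma :
    Algebra.adjoin ℂ {sigma1 (p * q) p, sigma2 (p * q) p} = (⊤ : Subalgebra ℂ (R (p * q) p)) := by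
  apply Subalgebra.map_injective (f := (R (p * q) p).val) Subtype.val_injective
  rw [AlgHom.map_adjoin, Algebra.map_top, Subalgebra.range_val, Set.image_pair]
  simp only [Subalgebra.coe_val, coe_sigma1 hp, coe_sigma2]
  exact (R_eq_adjoin hp hq).symm

theorem exists_mul_pow_eq_and_pow_add_pow_eq (s₀ t₀ : ℂ) :
    ∃ x y : ℂ, (x * y) ^ q = s₀ ∧ x ^ (p * q) + y ^ (p * q) = t₀ := by
  have hm : 0 < p * q := Nat.mul_pos hp hq
  obtain ⟨w, hw⟩ := IsAlgClosed.exists_pow_nat_eq s₀ hq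
  obtain ⟨d, hd⟩ := IsAlgClosed.exists_pow_nat_eq (t₀ ^ 2 - 4 * w ^ (p * q)) two_pos
  have huv : (t₀ + d) / 2 * ((t₀ - d) / 2) = w ^ (p * q) := by linear_combination -hd / 4
  obtain ⟨x, hx⟩ := IsAlgClosed.exists_pow_nat_eq ((t₀ + d) / 2) hm
  obtain rfl | hx0 := eq_or_ne x 0
  · rw [zero_pow hm.ne'] at hx
    rw [← hx, zero_mul] at huv
    obtain rfl := (pow_eq_zero_iff hm.ne').mp huv.symm
    obtain ⟨y, hy⟩ := IsAlgClosed.exists_pow_nat_eq t₀ hm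
    exact ⟨0, y, by rw [zero_mul, hw], by rw [zero_pow hm.ne', hy, zero_add]⟩
  · refine ⟨x, w / x, by rw [mul_div_cancel₀ _ hx0, hw], ?_⟩
    rw [div_pow, ← huv, ← hx, mul_div_cancel_left₀ _ (pow_ne_zero _ hx0), hx]
    ring

theorem algebraicIndependent_sigma :
    AlgebraicIndependent ℂ ![sigma1 (p * q) p, sigma2 (p * q) p] := by
  rw [algebraicIndependent_iff]
  intro P hP
  refine MvPolynomial.funext fun v => ?_
  obtain ⟨x, y, hs, ht⟩ := exists_mul_pow_eq_and_pow_add_pow_eq hp hq (v 0) (v 1)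
  let ev : R (p * q) p →ₐ[ℂ] ℂ := (aeval ![x, y]).comp (R (p * q) p).val
  have hv : (fun i => ev (![sigma1 (p * q) p, sigma2 (p * q) p] i)) = v := by
    funext i
    fin_cases i
    · simpa [ev, coe_sigma1 hp] using hs
    · simpa [ev, coe_sigma2] using ht
  have h := congrArg ev hP
  rw [map_zero, comp_aeval_apply, hv] at h
  rw [map_zero]
  exact h

end BasicInvariants

/-! ### The reflecting hyperplanes -/

/-- The line `{c.1 x + c.2 y = 0}` in the plane. -/
def line (c : ℂ × ℂ) : Submodule ℂ (Fin 2 → ℂ) :=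
  LinearMap.ker (c.1 • LinearMap.proj 0 + c.2 • LinearMap.proj 1 : Module.Dual ℂ (Fin 2 → ℂ))

theorem mem_line {c : ℂ × ℂ} {v : Fin 2 → ℂ} : v ∈ line c ↔ c.1 * v 0 + c.2 * v 1 = 0 := by
  rw [line, LinearMap.mem_ker]
  rfl

theorem finrank_line_add_one {c : ℂ × ℂ} (hc : c ≠ 0) : Module.finrank ℂ (line c) + 1 = 2 := by
  rw [line, Module.Dual.finrank_ker_add_one_of_ne_zero, Module.finrank_fin_fun]
  intro h
  exact hc (Prod.ext (by simpa using LinearMap.congr_fun h ![1, 0])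
    (by simpa using LinearMap.congr_fun h ![0, 1]))

/-- The linear form `c.1 x + c.2 y`. -/
def linForm (c : ℂ × ℂ) : MvPolynomial (Fin 2) ℂ := C c.1 * X 0 + C c.2 * X 1

theorem isDefiningForm_linForm (c : ℂ × ℂ) : IsDefiningForm (line c) (linForm c) :=
  ⟨(isHomogeneous_C_mul_X _ _).add (isHomogeneous_C_mul_X _ _), fun v => by
    rw [mem_line]; simp [linForm]⟩

section FixedSpace

theorem mem_fixedSpace {n : ℕ} {g : Matrix.GeneralLinearGroup (Fin n) ℂ} {v : Fin n → ℂ} :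
    v ∈ fixedSpace g ↔ (g : Matrix (Fin n) (Fin n) ℂ).mulVec v = v := by
  rw [fixedSpace, LinearMap.mem_ker, LinearMap.sub_apply, sub_eq_zero]
  rfl

variable {a b : ℂˣ} {v : Fin 2 → ℂ}

theorem mem_fixedSpace_diagGL :
    v ∈ fixedSpace (diagGL a b) ↔ (a = 1 ∨ v 0 = 0) ∧ (b = 1 ∨ v 1 = 0) := by
  rw [mem_fixedSpace, funext_iff, Fin.forall_fin_two]
  simp [diagGL, Matrix.mulVec, dotProduct, Fin.sum_univ_two, mul_left_eq_self₀]

theorem mem_fixedSpace_antidiagGL :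
    v ∈ fixedSpace (antidiagGL a b) ↔ a * v 1 = v 0 ∧ b * v 0 = v 1 := by
  rw [mem_fixedSpace, funext_iff, Fin.forall_fin_two]
  simp [antidiagGL, Matrix.mulVec, dotProduct, Fin.sum_univ_two]

theorem fixedSpace_diagGL_one_right (ha : a ≠ 1) : fixedSpace (diagGL a 1) = line (1, 0) := by
  ext v
  simp [mem_fixedSpace_diagGL, mem_line, ha]

theorem fixedSpace_diagGL_one_left (hb : b ≠ 1) : fixedSpace (diagGL 1 b) = line (0, 1) := by
  ext v
  simp [mem_fixedSpace_diagGL, mem_line, hb]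

theorem fixedSpace_diagGL_one_one : fixedSpace (diagGL 1 1) = ⊤ := by
  ext v
  simp [mem_fixedSpace_diagGL]

theorem fixedSpace_diagGL_eq_bot (ha : a ≠ 1) (hb : b ≠ 1) : fixedSpace (diagGL a b) = ⊥ := by
  ext v
  simp [mem_fixedSpace_diagGL, ha, hb, funext_iff]

theorem fixedSpace_antidiagGL_inv (a : ℂˣ) :
    fixedSpace (antidiagGL a a⁻¹) = line (1, -(a : ℂ)) := by
  ext v
  rw [mem_fixedSpace_antidiagGL, mem_line, Units.inv_mul_eq_iff_eq_mul, eq_comm, and_self,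
    one_mul, neg_mul, add_neg_eq_zero]

theorem fixedSpace_antidiagGL_eq_bot (hab : a * b ≠ 1) : fixedSpace (antidiagGL a b) = ⊥ := by
  rw [Submodule.eq_bot_iff]
  intro v hv
  obtain ⟨h₀, h₁⟩ := mem_fixedSpace_antidiagGL.mp hv
  have hv₀ : (a * b : ℂ) * v 0 = v 0 := by rw [mul_assoc, h₁, h₀]
  rw [mul_left_eq_self₀, ← Units.val_mul, Units.val_eq_one, or_iff_right hab] at hv₀
  funext i
  fin_cases i
  · exact hv₀
  · exact h₁.symm.trans (by rw [hv₀, mul_zero]; rfl)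

end FixedSpace

/-- Indices of the reflecting lines of `G(m,p,2)`, for `m ≠ p`: two coordinate axes, and the lines
`x = ζ y` with `ζ ^ m = 1`. -/
abbrev LineIdx (m : ℕ) : Type := Fin 2 ⊕ rootsOfUnity m ℂ

/-- The coefficients of the linear forms defining the reflecting lines of `G(m,p,2)`. -/
def lineCoeff {m : ℕ} : LineIdx m → ℂ × ℂ :=
  Sum.elim ![(1, 0), (0, 1)] fun ζ => (1, -((ζ : ℂˣ) : ℂ))

theorem lineCoeff_ne_zero {m : ℕ} (i : LineIdx m) : lineCoeff i ≠ 0 := by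
  rcases i with i | ζ
  · fin_cases i <;> simp [lineCoeff]
  · simp [lineCoeff]

theorem line_lineCoeff_injective (m : ℕ) :
    Function.Injective fun i : LineIdx m => line (lineCoeff i) := by
  intro i j (h : line (lineCoeff i) = line (lineCoeff j))
  have hmem : (![-(lineCoeff i).2, (lineCoeff i).1] : Fin 2 → ℂ) ∈ line (lineCoeff j) := by
    rw [← h, mem_line]
    simp [mul_comm]
  rw [mem_line] at hmem
  rcases i with i | ζ <;> rcases j with j | ξ
  · fin_cases i <;> fin_cases j <;> simp [lineCoeff] at hmem ⊢
  · fin_cases i <;> simp [lineCoeff] at hmem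
  · fin_cases j <;> simp [lineCoeff] at hmem
  · have h₁ : ((ζ : ℂˣ) : ℂ) = (ξ : ℂˣ) := by
      simpa [lineCoeff, ← sub_eq_add_neg, sub_eq_zero] using hmem
    rw [Subtype.ext (Units.ext h₁)]

theorem exists_line_eq_fixedSpace {m p : ℕ} {g : Matrix.GeneralLinearGroup (Fin 2) ℂ}
    (hg : g ∈ Gmpn m p 2) (hW : Module.finrank ℂ (fixedSpace g) + 1 = 2) :
    ∃ i : LineIdx m, line (lineCoeff i) = fixedSpace g := by
  obtain ⟨a, b, ha, -, -, rfl | rfl⟩ := mem_Gmpn_two_iff.mp hg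
  · obtain rfl | ha₁ := eq_or_ne a 1 <;> obtain rfl | hb₁ := eq_or_ne b 1
    · rw [fixedSpace_diagGL_one_one, finrank_top, Module.finrank_fin_fun] at hW
      lia
    · exact ⟨.inl 1, (fixedSpace_diagGL_one_left hb₁).symm⟩
    · exact ⟨.inl 0, (fixedSpace_diagGL_one_right ha₁).symm⟩
    · rw [fixedSpace_diagGL_eq_bot ha₁ hb₁, finrank_bot] at hW
      lia
  · obtain hab | hab := eq_or_ne (a * b) 1
    · obtain rfl := eq_inv_of_mul_eq_one_right hab
      exact ⟨.inr ⟨a, ha⟩, (fixedSpace_antidiagGL_inv a).symm⟩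
    · rw [fixedSpace_antidiagGL_eq_bot hab, finrank_bot] at hW
      lia

section Arrangement

variable {p q : ℕ} (hp : 0 < p)

include hp in
theorem diagGL_mem_Gmpn_of_pow_eq_one {a b : ℂˣ} (ha : a ^ q = 1) (hb : b ^ q = 1) :
    diagGL a b ∈ Gmpn (p * q) p 2 :=
  mem_Gmpn_two_iff.mpr ⟨a, b, by rw [mul_comm, pow_mul, ha, one_pow],
    by rw [mul_comm, pow_mul, hb, one_pow],
    by rw [Nat.mul_div_cancel_left q hp, mul_pow, ha, hb, one_mul], .inl rfl⟩

theorem antidiagGL_inv_mem_Gmpn {m : ℕ} (p : ℕ) {a : ℂˣ} (ha : a ^ m = 1) :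
    antidiagGL a a⁻¹ ∈ Gmpn m p 2 :=
  mem_Gmpn_two_iff.mpr ⟨a, a⁻¹, ha, by rw [inv_pow, ha, inv_one],
    by rw [mul_inv_cancel, one_pow], .inr rfl⟩

include hp in
theorem exists_fixedSpace_eq_line (hq : 1 < q) (i : LineIdx (p * q)) :
    ∃ g ∈ Gmpn (p * q) p 2, fixedSpace g = line (lineCoeff i) := by
  have hω := (Complex.isPrimitiveRoot_exp q (by lia)).isUnit_unit (by lia)
  rcases i with i | ζ
  · fin_cases i
    · exact ⟨_, diagGL_mem_Gmpn_of_pow_eq_one hp hω.pow_eq_one (one_pow _),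
        fixedSpace_diagGL_one_right (hω.ne_one hq)⟩
    · exact ⟨_, diagGL_mem_Gmpn_of_pow_eq_one hp (one_pow _) hω.pow_eq_one,
        fixedSpace_diagGL_one_left (hω.ne_one hq)⟩
  · exact ⟨_, antidiagGL_inv_mem_Gmpn p ζ.2, fixedSpace_antidiagGL_inv _⟩

include hp in
theorem hyperplanes_Gmpn_two (hq : 1 < q) : hyperplanes (Gmpn (p * q) p 2) =
    Set.range fun i : LineIdx (p * q) => line (lineCoeff i) := by
  ext W
  constructor
  · rintro ⟨hW, g, hg, rfl⟩
    exact exists_line_eq_fixedSpace hg hW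
  · rintro ⟨i, rfl⟩
    exact ⟨finrank_line_add_one (lineCoeff_ne_zero i), exists_fixedSpace_eq_line hp hq i⟩

/-! ### The orders of the pointwise stabilizers -/

theorem fixerOrder_eq_ncard {n : ℕ} (G : Subgroup (Matrix.GeneralLinearGroup (Fin n) ℂ))
    (W : Submodule ℂ (Fin n → ℂ)) : fixerOrder G W = {g | g ∈ G ∧ W ≤ fixedSpace g}.ncard :=
  rfl

theorem diagGL_injective2 : Function.Injective2 diagGL := fun a a' b b' h => by
  have h' (i : Fin 2) : (diagGL a b : Matrix (Fin 2) (Fin 2) ℂ) i i = diagGL a' b' i i := by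
    rw [h]
  exact ⟨Units.ext (by simpa [diagGL] using h' 0), Units.ext (by simpa [diagGL] using h' 1)⟩

theorem diagGL_ne_antidiagGL (a b c d : ℂˣ) : diagGL a b ≠ antidiagGL c d := fun h => by
  have h' : (diagGL a b : Matrix (Fin 2) (Fin 2) ℂ) 0 0 = antidiagGL c d 0 0 := by rw [h]
  simp [diagGL, antidiagGL] at h'

include hp in
theorem fixer_line_inl_zero :
    {g | g ∈ Gmpn (p * q) p 2 ∧ line (1, 0) ≤ fixedSpace g} =
      (diagGL · 1) '' {a | a ^ q = 1} := by
  ext g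
  constructor
  · rintro ⟨hg, hW⟩
    have hv : ![0, 1] ∈ fixedSpace g := hW (by simp [mem_line])
    obtain ⟨a, b, -, -, hab, rfl | rfl⟩ := mem_Gmpn_two_iff.mp hg
    · obtain rfl : b = 1 := by simpa using (mem_fixedSpace_diagGL.mp hv).2
      rw [Nat.mul_div_cancel_left q hp, mul_one] at hab
      exact ⟨a, hab, rfl⟩
    · simp [mem_fixedSpace_antidiagGL] at hv
  · rintro ⟨a, ha, rfl⟩
    refine ⟨diagGL_mem_Gmpn_of_pow_eq_one hp ha (one_pow q), fun v hv => ?_⟩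
    exact mem_fixedSpace_diagGL.mpr ⟨.inr (by simpa [mem_line] using hv), .inl rfl⟩

include hp in
theorem fixer_line_inl_one :
    {g | g ∈ Gmpn (p * q) p 2 ∧ line (0, 1) ≤ fixedSpace g} =
      (diagGL 1 ·) '' {b | b ^ q = 1} := by
  ext g
  constructor
  · rintro ⟨hg, hW⟩
    have hv : ![1, 0] ∈ fixedSpace g := hW (by simp [mem_line])
    obtain ⟨a, b, -, -, hab, rfl | rfl⟩ := mem_Gmpn_two_iff.mp hg
    · obtain rfl : a = 1 := by simpa using (mem_fixedSpace_diagGL.mp hv).1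
      rw [Nat.mul_div_cancel_left q hp, one_mul] at hab
      exact ⟨b, hab, rfl⟩
    · simp [mem_fixedSpace_antidiagGL] at hv
  · rintro ⟨b, hb, rfl⟩
    refine ⟨diagGL_mem_Gmpn_of_pow_eq_one hp (one_pow q) hb, fun v hv => ?_⟩
    exact mem_fixedSpace_diagGL.mpr ⟨.inl rfl, .inr (by simpa [mem_line] using hv)⟩

include hp in
theorem fixerOrder_line_inl (hq : 0 < q) (i : Fin 2) :
    fixerOrder (Gmpn (p * q) p 2) (line (lineCoeff (.inl i : LineIdx (p * q)))) = q := by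
  have : NeZero q := ⟨hq.ne'⟩
  have hcard : {a : ℂˣ | a ^ q = 1}.ncard = q := Complex.card_rootsOfUnity q
  rw [fixerOrder_eq_ncard]
  fin_cases i
  · exact (congrArg Set.ncard (fixer_line_inl_zero hp)).trans
      ((Set.ncard_image_of_injective _ (diagGL_injective2.left 1)).trans hcard)
  · exact (congrArg Set.ncard (fixer_line_inl_one hp)).trans
      ((Set.ncard_image_of_injective _ (diagGL_injective2.right 1)).trans hcard)

theorem fixer_line_inr {m : ℕ} (p : ℕ) (ζ : rootsOfUnity m ℂ) :
    {g | g ∈ Gmpn m p 2 ∧ line (lineCoeff (.inr ζ)) ≤ fixedSpace g} =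
      {diagGL 1 1, antidiagGL ζ (ζ : ℂˣ)⁻¹} := by
  ext g
  constructor
  · rintro ⟨hg, hW⟩
    have hv : ![((ζ : ℂˣ) : ℂ), 1] ∈ fixedSpace g := hW (by simp [mem_line, lineCoeff])
    obtain ⟨a, b, -, -, -, rfl | rfl⟩ := mem_Gmpn_two_iff.mp hg
    · obtain ⟨rfl, rfl⟩ : a = 1 ∧ b = 1 := by simpa [mem_fixedSpace_diagGL] using hv
      exact .inl rfl
    · obtain ⟨ha, hb⟩ := mem_fixedSpace_antidiagGL.mp hv
      have ha' : a = ζ := Units.ext (by simpa using ha)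
      have hb' : b = (ζ : ℂˣ)⁻¹ := eq_inv_of_mul_eq_one_left (Units.ext (by simpa using hb))
      rw [ha', hb']
      exact .inr rfl
  · rintro (rfl | rfl)
    · exact ⟨mem_Gmpn_two_iff.mpr ⟨1, 1, by simp⟩, fixedSpace_diagGL_one_one ▸ le_top⟩
    · exact ⟨antidiagGL_inv_mem_Gmpn p ζ.2, (fixedSpace_antidiagGL_inv _).ge⟩

theorem fixerOrder_line_inr {m : ℕ} (p : ℕ) (ζ : rootsOfUnity m ℂ) :
    fixerOrder (Gmpn m p 2) (line (lineCoeff (.inr ζ))) = 2 := by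
  rw [fixerOrder_eq_ncard, fixer_line_inr, Set.ncard_pair (diagGL_ne_antidiagGL _ _ _ _)]

/-! ### The products of the defining forms -/

theorem prod_linForm_inr (m : ℕ) [NeZero m] [Fintype (rootsOfUnity m ℂ)] :
    ∏ ζ : rootsOfUnity m ℂ, linForm (lineCoeff (.inr ζ)) = X 0 ^ m - X 1 ^ m := by
  have hm : 0 < m := Nat.pos_of_neZero m
  have hω := (Complex.isPrimitiveRoot_exp m hm.ne').map_of_injective (C_injective (Fin 2) ℂ)
  rw [hω.pow_sub_pow_eq_prod_sub_mul _ _ hm]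
  refine Finset.prod_bij (fun ζ _ => C ((ζ : ℂˣ) : ℂ)) (fun ζ _ => ?_)
    (fun ζ _ ξ _ h => Subtype.ext (Units.ext (C_injective _ _ h))) (fun ξ hξ => ?_)
    fun ζ _ => by simp [linForm, lineCoeff, sub_eq_add_neg]
  · rw [Polynomial.mem_nthRootsFinset hm, ← C_pow, ← Units.val_pow_eq_pow_val, ζ.2,
      Units.val_one, C_1]
  · rw [Polynomial.mem_nthRootsFinset hm] at hξ
    obtain ⟨i, -, rfl⟩ := hω.eq_pow_of_pow_eq_one hξ
    rw [← C_pow, ← C_pow, ← C_1] at hξ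
    exact ⟨rootsOfUnity.mkOfPowEq _ (C_injective _ _ hξ), Finset.mem_univ _, C_pow _ _⟩

theorem prod_linForm (m : ℕ) [NeZero m] [Fintype (rootsOfUnity m ℂ)] :
    ∏ i : LineIdx m, linForm (lineCoeff i) = z m := by
  rw [Fintype.prod_sum_type, prod_linForm_inr, Fin.prod_univ_two, z]
  simp [linForm, lineCoeff]

include hp in
theorem prod_linForm_pow_fixerOrder (hq : 0 < q) [NeZero (p * q)]
    [Fintype (rootsOfUnity (p * q) ℂ)] :
    ∏ i : LineIdx (p * q),
        linForm (lineCoeff i) ^ fixerOrder (Gmpn (p * q) p 2) (line (lineCoeff i)) =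
      (Delta (p * q) p : MvPolynomial (Fin 2) ℂ) := by
  have hΔ : (Delta (p * q) p : MvPolynomial (Fin 2) ℂ) =
      (X 0 * X 1) ^ q * ((X 0 ^ (p * q) + X 1 ^ (p * q)) ^ 2 - 4 * ((X 0 * X 1) ^ q) ^ p) := by
    rw [← coe_sigma1 hp]
    rfl
  simp only [Fintype.prod_sum_type, fixerOrder_line_inl hp hq, fixerOrder_line_inr]
  rw [Finset.prod_pow, Finset.prod_pow, prod_linForm_inr, hΔ, Fin.prod_univ_two]
  have h₀ : linForm (lineCoeff (.inl 0 : LineIdx (p * q))) = X 0 := by simp [linForm, lineCoeff]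
  have h₁ : linForm (lineCoeff (.inl 1 : LineIdx (p * q))) = X 1 := by simp [linForm, lineCoeff]
  rw [h₀, h₁]
  ring

include hp in
theorem exists_defining_forms (hq : 1 < q) :
    ∃ α : Submodule ℂ (Fin 2 → ℂ) → MvPolynomial (Fin 2) ℂ,
      (∀ W ∈ hyperplanes (Gmpn (p * q) p 2), IsDefiningForm W (α W)) ∧
      (hyperplanes (Gmpn (p * q) p 2)).Finite ∧
      z (p * q) = ∏ᶠ W ∈ hyperplanes (Gmpn (p * q) p 2), α W ∧
      (Delta (p * q) p : MvPolynomial (Fin 2) ℂ) =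
        ∏ᶠ W ∈ hyperplanes (Gmpn (p * q) p 2), α W ^ fixerOrder (Gmpn (p * q) p 2) W := by
  have : NeZero (p * q) := ⟨(Nat.mul_pos hp (by lia)).ne'⟩
  have := Fintype.ofFinite (rootsOfUnity (p * q) ℂ)
  have hinj := line_lineCoeff_injective (p * q)
  rw [hyperplanes_Gmpn_two hp hq]
  refine ⟨Function.extend (fun i : LineIdx (p * q) => line (lineCoeff i))
    (fun i => linForm (lineCoeff i)) 0, ?_, Set.finite_range _, ?_, ?_⟩
  · rintro _ ⟨i, rfl⟩
    exact hinj.extend_apply _ _ i ▸ isDefiningForm_linForm _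
  · rw [finprod_mem_range hinj, finprod_eq_prod_of_fintype]
    simp only [hinj.extend_apply, prod_linForm]
  · rw [finprod_mem_range hinj, finprod_eq_prod_of_fintype]
    simp only [hinj.extend_apply, prod_linForm_pow_fixerOrder hp (Nat.zero_lt_of_lt hq)]

end Arrangement

/-! ### Multiplication by `z` -/

section SModZ

variable {p : ℕ} (hp : 0 < p)

/-- The `R`-basis of `ℂ[x, y]` by pairs of monomials. -/
def combinationEquiv {q : ℕ} (hq : 0 < q) :
    (Fin q × Fin q × Fin p → Fin 2 → R (p * q) p) ≃ₗ[R (p * q) p] MvPolynomial (Fin 2) ℂ :=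
  LinearEquiv.ofBijective (combination (R (p * q) p) (X 0) (X 1) p q)
    ⟨combination_injective hp hq, combination_surjective hp hq
      (s := sigma1 (p * q) p) (t := sigma2 (p * q) p) (coe_sigma1 hp) (coe_sigma2 (p := p) _)⟩

theorem z_mul_combinationEquiv {q : ℕ} (hq : 0 < q)
    (u : Fin q × Fin q × Fin p → Fin 2 → R (p * q) p) :
    z (p * q) * combinationEquiv hp hq u = combinationEquiv hp hq fun i =>
      (zBlock (sigma1 (p * q) p) (sigma2 (p * q) p) p i.1 i.2.1 i.2.2).mulVec
        (u (sourceIndex p q i)) :=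
  mul_combination (B := R (p * q) p) (s := sigma1 (p * q) p) (t := sigma2 (p * q) p)
    (coe_sigma1 hp) (coe_sigma2 (p := p) _) u

/-- `S/(z)` is the cokernel of multiplication by `z`. -/
def sModZEquivQuotientRange {m : ℕ} (hm : 0 < m) (hpm : p ∣ m) : SModZ hm hpm ≃ₗ[R m p]
    MvPolynomial (Fin 2) ℂ ⧸ LinearMap.range (LinearMap.mulLeft (R m p) (z m)) :=
  (Submodule.Quotient.restrictScalarsEquiv (R m p) (Ideal.span {z m})).symm.trans
    (Submodule.quotEquivOfEq _ _ (by
      ext f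
      simp [Ideal.mem_span_singleton, dvd_def, eq_comm]))

/-- `S/(z)` is the direct sum of the cokernels of the blocks of multiplication by `z`. -/
def sModZEquivBlocks {q : ℕ} (hq : 0 < q) (hm : 0 < p * q) (hpm : p ∣ p * q) :
    SModZ hm hpm ≃ₗ[R (p * q) p] ((i : Fin q × Fin q × Fin p) → Cokernel
      (zBlock (sigma1 (p * q) p) (sigma2 (p * q) p) p i.1 i.2.1 i.2.2)) :=
  (sModZEquivQuotientRange hm hpm).trans <|
    quotientRangeEquivPiCokernel (combinationEquiv hp hq)
      (LinearMap.mulLeft (R (p * q) p) (z (p * q))) (sourceIndex p q)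
      (fun i => zBlock (sigma1 (p * q) p) (sigma2 (p * q) p) p i.1 i.2.1 i.2.2)
      (z_mul_combinationEquiv hp hq)

end SModZ

set_option synthInstance.maxHeartbeats 200000 in
-- The search for `SMul R (R/(Δ))` tries every subalgebra structure on the subtype `R`.
instance isScalarTowerSModZ {m p : ℕ} (hm : 0 < m) (hpm : p ∣ m) :
    IsScalarTower (R m p) (RDelta m p) (SModZ hm hpm) :=
  (SModZ.isTorsion hm hpm).isScalarTower

end ReflGroup

end

open ReflGroup in
theorem mainTheorem7 (m p q : ℕ) (hm : 0 < m) (hpm : p ∣ m) (hne : m ≠ p) (hp : Even p)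
    (hq : q = m / p) :
    -- `σ₁`, `σ₂` are basic invariants: `R = ℂ[σ₁, σ₂]` is a polynomial ring
    (AlgebraicIndependent ℂ ![sigma1 m p, sigma2 m p] ∧
      Algebra.adjoin ℂ {sigma1 m p, sigma2 m p} = (⊤ : Subalgebra ℂ (R m p))) ∧
    -- `z = ∏ α_W` and `Δ = ∏ α_W ^ e_W` over the reflecting hyperplanes `W` of `G(m,p,2)`
    (∃ α : Submodule ℂ (Fin 2 → ℂ) → MvPolynomial (Fin 2) ℂ,
      (∀ W ∈ hyperplanes (Gmpn m p 2), IsDefiningForm W (α W)) ∧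
      (hyperplanes (Gmpn m p 2)).Finite ∧
      z m = ∏ᶠ W ∈ hyperplanes (Gmpn m p 2), α W ∧
      (Delta m p : MvPolynomial (Fin 2) ℂ) =
        ∏ᶠ W ∈ hyperplanes (Gmpn m p 2), α W ^ fixerOrder (Gmpn m p 2) W) ∧
    -- the two forms of the decomposition of `S/(z)` over `R/(Δ)`
    Nonempty (SModZ hm hpm ≃ₗ[RDelta m p]
      ((j : Finset.Icc 1 p) → Fin (2 * (q - 1)) →
        XMod (sigma1 m p) (sigma2 m p) (p := p) j (le_of_mem_Icc j)) ×
      ((j : Finset.Icc 1 ((p - 2) / 2)) → Fin 2 →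
        NMod (sigma1 m p) (sigma2 m p) (p := p) j (le_of_mem_Icc_half j)) ×
      ((j : Finset.Icc 1 ((p - 2) / 2)) → Fin (2 * (q - 1) ^ 2) →
        KMod (sigma1 m p) (sigma2 m p) (p := p) j (le_of_mem_Icc_half j)) ×
      (Fin (2 * (q - 1).choose 2) →
        KMod (sigma1 m p) (sigma2 m p) (p := p) (p / 2) (Nat.div_le_self p 2)) ×
      (Fin (2 * (q - 1).choose 2) →
        KMod (sigma1 m p) (sigma2 m p) (p := p) 0 (Nat.zero_le p)) ×
      AMod (sigma1 m p) (sigma2 m p) p ×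
      (Fin (q - 1) → BMod (sigma1 m p) (sigma2 m p) p) ×
      CPlus (sigma1 m p) (sigma2 m p) hp ×
      (Fin (q - 1) → DPlus (sigma1 m p) (sigma2 m p) hp) ×
      CMinus (sigma1 m p) (sigma2 m p) hp ×
      (Fin (q - 1) → DMinus (sigma1 m p) (sigma2 m p) hp) ×
      RDelta m p) ∧
    Nonempty (SModZ hm hpm ≃ₗ[RDelta m p]
      ((j : Finset.Icc 1 p) → Fin (2 * (q - 1)) →
        XMod (sigma1 m p) (sigma2 m p) (p := p) j (le_of_mem_Icc j)) ×
      ((j : Finset.Icc 1 ((p - 2) / 2)) → Fin 2 →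
        NMod (sigma1 m p) (sigma2 m p) (p := p) j (le_of_mem_Icc_half j)) ×
      ((j : Finset.Icc 1 ((p - 2) / 2)) → Fin (2 * (q - 1) ^ 2) →
        KMod (sigma1 m p) (sigma2 m p) (p := p) j (le_of_mem_Icc_half j)) ×
      AMod (sigma1 m p) (sigma2 m p) p ×
      (Fin (q - 1 + 2 * (q - 1).choose 2) → BMod (sigma1 m p) (sigma2 m p) p) ×
      CPlus (sigma1 m p) (sigma2 m p) hp ×
      (Fin (q - 1 + 2 * (q - 1).choose 2) → DPlus (sigma1 m p) (sigma2 m p) hp) ×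
      CMinus (sigma1 m p) (sigma2 m p) hp ×
      (Fin (q - 1 + 2 * (q - 1).choose 2) → DMinus (sigma1 m p) (sigma2 m p) hp) ×
      RDelta m p) := by
  obtain ⟨q', rfl⟩ := hpm
  have hp0 : 0 < p := Nat.pos_of_mul_pos_right hm
  rw [Nat.mul_div_cancel_left _ hp0] at hq
  subst hq
  have hq0 : 0 < q := Nat.pos_of_mul_pos_left hm
  have hq1 : 1 < q := by
    refine lt_of_le_of_ne hq0 ?_
    rintro rfl
    exact hne (mul_one p)
  obtain ⟨n, rfl⟩ := Nat.exists_eq_add_one_of_ne_zero hq0.ne'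
  let _ : Invertible (2 : R (p * (n + 1)) p) :=
    (Invertible.map (algebraMap ℂ (R (p * (n + 1)) p)) 2).copy _ (map_ofNat _ 2).symm
  have e := sModZEquivBlocks hp0 hq0 hm ⟨n + 1, rfl⟩
  refine ⟨⟨algebraicIndependent_sigma hp0 hq0, adjoin_sigma hp0 hq0⟩,
    exists_defining_forms hp0 hq1, ?_, ?_⟩ <;> rw [Nat.add_sub_cancel]
  · exact ⟨equivFirstDecomposition _ _ e hp hp0⟩
  · exact ⟨equivSecondDecomposition _ _ e hp hp0⟩
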